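/- All C*-algebras are complex and not necessarily unital, and an ideal is a closed, two-sided ideal. For a C*-algebra $A$, let $\mathrm{gr}_0(A)$ be the smallest integer $n\ge 0$ such that for all self-adjoint $a_0,\dots,a_n\in A$, all $\varepsilon>0$ and all $c\in A$ there are self-adjoint $b_0,\dots,b_n\in A$ and an element $d$ of the sub-C*-algebra $C^*(b_0,\dots,b_n)\subseteq A$ generated by $b_0,\dots,b_n$ with $\|b_j-a_j\|<\varepsilon$ for all $j$ and $\|c-d\|<\varepsilon$; set $\mathrm{gr}_0(A)=\infty$ if there is no such $n$. The generator rank of $A$ is $\mathrm{gr}(A):=\mathrm{gr}_0(\widetilde A)$, where $\widetilde A$ is the minimal unitization of $A$ (so $\widetilde A=A$ if $A$ is unital). Let $\mathrm{Prim}(A)$ be the set of primitive ideals of $A$, that is, kernels of nonzero irreducible $*$-representations of $A$ on Hilbert spaces, and for an ideal $I\subseteq A$ let $\mathrm{hull}(I):=\{J\in\mathrm{Prim}(A): I\subseteq J\}$. Let $A$ be a separable C*-algebra, and let $(I_k)_{k\in\mathbb{N}}$ be a decreasing sequence of ideals of $A$ with $\bigcup_k \mathrm{hull}(I_k)=\mathrm{Prim}(A)$.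 Then \[ \mathrm{gr}_0(A)=\sup_k \mathrm{gr}_0(A/I_k)\quad\text{and}\quad \mathrm{gr}(A)=\sup_k \mathrm{gr}(A/I_k). \] -/

import Mathlib

open scoped CStarAlgebra

universe u

/-- An ideal of a C⋆-algebra: a norm-closed linear subspace that is stable under left and right
multiplication by arbitrary elements. -/
structure ClosedIdeal (A : Type u) [NonUnitalCStarAlgebra A] extends Submodule ℂ A where
  mul_mem_left' : ∀ (a : A) {x : A}, x ∈ carrier → a * x ∈ carrier
  mul_mem_right' : ∀ (a : A) {x : A}, x ∈ carrier → x * a ∈ carrier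
  isClosed' : IsClosed carrier

namespace ClosedIdeal

variable {A : Type u} [NonUnitalCStarAlgebra A]

theorem toSubmodule_injective :
    Function.Injective (toSubmodule : ClosedIdeal A → Submodule ℂ A) := by
  rintro ⟨I, _, _, _⟩ ⟨J, _, _, _⟩ h
  congr

/-- Ideals are ordered by inclusion. -/
instance : PartialOrder (ClosedIdeal A) := PartialOrder.lift toSubmodule toSubmodule_injective

instance : Membership A (ClosedIdeal A) := ⟨fun I a => a ∈ I.toSubmodule⟩

theorem mem_def {I : ClosedIdeal A} {a : A} : a ∈ I ↔ a ∈ I.toSubmodule := Iff.rfl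

theorem mul_mem_left (I : ClosedIdeal A) (a : A) {x : A} (hx : x ∈ I) : a * x ∈ I :=
  I.mul_mem_left' a hx

theorem mul_mem_right (I : ClosedIdeal A) (a : A) {x : A} (hx : x ∈ I) : x * a ∈ I :=
  I.mul_mem_right' a hx

theorem isClosed (I : ClosedIdeal A) : IsClosed (I.toSubmodule : Set A) := I.isClosed'

/-- The elements `x` such that `x` and `star x` both lie in the ideal (a posteriori, the
whole ideal). -/
def starPart (I : ClosedIdeal A) : NonUnitalStarSubalgebra ℂ A where
  carrier := {x | x ∈ I ∧ star x ∈ I}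
  add_mem' {x y} hx hy := ⟨I.toSubmodule.add_mem hx.1 hy.1, by
    rw [star_add]; exact I.toSubmodule.add_mem hx.2 hy.2⟩
  zero_mem' := ⟨I.toSubmodule.zero_mem, by rw [star_zero]; exact I.toSubmodule.zero_mem⟩
  mul_mem' {x y} hx hy := ⟨I.mul_mem_left x hy.1, by
    rw [star_mul]; exact I.mul_mem_left _ hx.2⟩
  smul_mem' c x hx := ⟨I.toSubmodule.smul_mem c hx.1, by
    rw [star_smul]; exact I.toSubmodule.smul_mem _ hx.2⟩
  star_mem' {x} hx := ⟨hx.2, by rw [star_star]; exact hx.1⟩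

theorem mem_starPart {I : ClosedIdeal A} {x : A} : x ∈ I.starPart ↔ x ∈ I ∧ star x ∈ I := Iff.rfl

instance isClosed_starPart (I : ClosedIdeal A) : IsClosed (I.starPart : Set A) :=
  I.isClosed.inter (I.isClosed.preimage continuous_star)

theorem map_nonneg_of_starHom {B : Type u} [NonUnitalCStarAlgebra B] [PartialOrder B]
    [StarOrderedRing B] [PartialOrder A] [StarOrderedRing A] (f : B →⋆ₙₐ[ℂ] A) {x : B}
    (hx : 0 ≤ x) : 0 ≤ f x := map_nonneg f hx

/-- Approximate units: an element `y` of the self-adjoint part of the ideal is almost fixed by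
some self-adjoint `e` in the ideal with `‖1 - e‖ ≤ 1` in the unitization. -/
theorem exists_approx (I : ClosedIdeal A) {y : A} (hy : y ∈ I.starPart) {ε : ℝ} (hε : 0 < ε) :
    ∃ e ∈ I, IsSelfAdjoint e ∧ ‖(1 : A⁺¹) - (e : A⁺¹)‖ ≤ 1 ∧ ‖y - y * e‖ < ε := by
  let : PartialOrder A := CStarAlgebra.spectralOrder A
  let : StarOrderedRing A := CStarAlgebra.spectralOrderedRing A
  let : PartialOrder I.starPart := CStarAlgebra.spectralOrder I.starPart
  let : StarOrderedRing I.starPart := CStarAlgebra.spectralOrderedRing I.starPart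
  have H := CStarAlgebra.increasingApproximateUnit I.starPart
  have h1 := H.tendsto_mul_left (⟨y, hy⟩ : I.starPart)
  have h2 := Metric.tendsto_nhds.1 h1 ε hε
  have := H.neBot
  obtain ⟨e, he, hn, hd⟩ := (H.eventually_nonneg.and (H.eventually_norm.and h2)).exists
  have hsa : IsSelfAdjoint (e : A) := congrArg Subtype.val he.isSelfAdjoint.star_eq
  have he0 : (0 : A) ≤ (e : A) :=
    map_nonneg_of_starHom (NonUnitalStarSubalgebraClass.subtype I.starPart) he
  have hn' : ‖((e : A) : A⁺¹)‖ ≤ 1 := by rw [Unitization.norm_inr]; exact hn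
  refine ⟨e, e.2.1, hsa, ?_, ?_⟩
  · have h0 : (0 : A⁺¹) ≤ ((e : A) : A⁺¹) := Unitization.inr_nonneg_iff.2 he0
    have h1 : ((e : A) : A⁺¹) ≤ 1 := (CStarAlgebra.norm_le_one_iff_of_nonneg _ h0).1 hn'
    exact (CStarAlgebra.norm_le_one_iff_of_nonneg _ (sub_nonneg.2 h1)).2 (sub_le_self _ h0)
  · rw [dist_comm, dist_eq_norm] at hd
    exact hd

/-- Closed two-sided ideals of C⋆-algebras are self-adjoint. -/
theorem star_mem (I : ClosedIdeal A) {x : A} (hx : x ∈ I) : star x ∈ I := by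
  have hy : x * star x ∈ I.starPart :=
    ⟨I.mul_mem_right _ hx, by rw [star_mul, star_star]; exact I.mul_mem_right _ hx⟩
  refine I.isClosed.closure_subset (Metric.mem_closure_iff.2 fun ε hε => ?_)
  obtain ⟨e, heI, hsa, h1, h2⟩ := I.exists_approx hy (ε := ε ^ 2) (by positivity)
  refine ⟨star x * e, I.mul_mem_left _ heI, ?_⟩
  rw [dist_eq_norm]
  refine lt_of_pow_lt_pow_left₀ 2 hε.le ?_
  calc ‖star x - star x * e‖ ^ 2
      = ‖star (star x - star x * e) * (star x - star x * e)‖ := by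
        rw [CStarRing.norm_star_mul_self, sq]
    _ = ‖((star (star x - star x * e) * (star x - star x * e) : A) : A⁺¹)‖ := by
        rw [Unitization.norm_inr]
    _ = ‖((1 : A⁺¹) - e) * ((x * star x - x * star x * e : A) : A⁺¹)‖ := by
        congr 1
        simp only [star_sub, star_mul, star_star, hsa.star_eq, Unitization.inr_sub,
          Unitization.inr_mul]
        noncomm_ring
    _ ≤ ‖(1 : A⁺¹) - e‖ * ‖((x * star x - x * star x * e : A) : A⁺¹)‖ := norm_mul_le _ _
    _ ≤ 1 * ‖x * star x - x * star x * e‖ := by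
        rw [Unitization.norm_inr]; gcongr
    _ < ε ^ 2 := by rwa [one_mul]

/-- The key inequality for the C⋆-identity in the quotient. -/
theorem exists_norm_sub_sq_le (I : ClosedIdeal A) (a : A) {x : A} (hx : x ∈ I) {ε : ℝ}
    (hε : 0 < ε) : ∃ y ∈ I, ‖a + y‖ ^ 2 ≤ ‖star a * a + x‖ + ε := by
  obtain ⟨e, heI, hsa, h1, h2⟩ := I.exists_approx (mem_starPart.2 ⟨hx, I.star_mem hx⟩) hε
  refine ⟨-(a * e), I.toSubmodule.neg_mem (I.mul_mem_left a heI), ?_⟩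
  calc ‖a + -(a * e)‖ ^ 2 = ‖star (a - a * e) * (a - a * e)‖ := by
        rw [CStarRing.norm_star_mul_self, sq, sub_eq_add_neg]
    _ = ‖((star (a - a * e) * (a - a * e) : A) : A⁺¹)‖ := by rw [Unitization.norm_inr]
    _ = ‖((1 : A⁺¹) - e) * ((star a * a + x : A) : A⁺¹) * (1 - e)
          - (1 - e) * ((x - x * e : A) : A⁺¹)‖ := by
        congr 1
        simp only [star_sub, star_mul, hsa.star_eq, Unitization.inr_sub,
          Unitization.inr_mul, Unitization.inr_add]
        noncomm_ring
    _ ≤ ‖(1 : A⁺¹) - e‖ * ‖((star a * a + x : A) : A⁺¹)‖ * ‖(1 : A⁺¹) - e‖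
          + ‖(1 : A⁺¹) - e‖ * ‖((x - x * e : A) : A⁺¹)‖ :=
        (norm_sub_le _ _).trans (add_le_add (norm_mul₃_le) (norm_mul_le _ _))
    _ ≤ 1 * ‖star a * a + x‖ * 1 + 1 * ‖x - x * e‖ := by
        rw [Unitization.norm_inr, Unitization.norm_inr]; gcongr
    _ ≤ ‖star a * a + x‖ + ε := by rw [one_mul, mul_one, one_mul]; gcongr

/-- The quotient `A / I`, as a vector space with the quotient norm. -/
def Quotient (I : ClosedIdeal A) : Type u := A ⧸ I.toSubmodule

namespace Quotient

variable (I : ClosedIdeal A)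

noncomputable instance : NormedAddCommGroup I.Quotient :=
  haveI : IsClosed (I.toSubmodule : Set A) := I.isClosed
  inferInstanceAs (NormedAddCommGroup (A ⧸ I.toSubmodule))

noncomputable instance : NormedSpace ℂ I.Quotient :=
  haveI : IsClosed (I.toSubmodule : Set A) := I.isClosed
  inferInstanceAs (NormedSpace ℂ (A ⧸ I.toSubmodule))

instance : CompleteSpace I.Quotient :=
  haveI : IsClosed (I.toSubmodule : Set A) := I.isClosed
  inferInstanceAs (CompleteSpace (A ⧸ I.toSubmodule))

/-- The quotient map `A → A / I`. -/
def mk : A →ₗ[ℂ] I.Quotient := I.toSubmodule.mkQ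

theorem mk_surjective : Function.Surjective (mk I) := Submodule.mkQ_surjective _

theorem mk_eq_mk {a b : A} : mk I a = mk I b ↔ a - b ∈ I := Submodule.Quotient.eq _

theorem mk_eq_zero {a : A} : mk I a = 0 ↔ a ∈ I := Submodule.Quotient.mk_eq_zero _

theorem norm_mk_le (a : A) : ‖mk I a‖ ≤ ‖a‖ := Submodule.Quotient.norm_mk_le _ a

theorem exists_rep_norm_lt (q : I.Quotient) {ε : ℝ} (hε : 0 < ε) :
    ∃ a, mk I a = q ∧ ‖a‖ < ‖q‖ + ε := Submodule.Quotient.norm_mk_lt q hε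

/-- Multiplication of classes, `(a + I)(b + I) = ab + I`. -/
instance : Mul I.Quotient :=
  ⟨_root_.Quotient.map₂ (sa := I.toSubmodule.quotientRel) (sb := I.toSubmodule.quotientRel)
    (sc := I.toSubmodule.quotientRel) (· * ·) (by
      intro a b hab c d hcd
      have h1 : a - b ∈ I := (Submodule.quotientRel_def _).1 hab
      have h2 : c - d ∈ I := (Submodule.quotientRel_def _).1 hcd
      refine (Submodule.quotientRel_def _).2 ?_
      have h3 : a * c - b * d = (a - b) * c + b * (c - d) := by noncomm_ring
      rw [h3]
      exact I.toSubmodule.add_mem (I.mul_mem_right _ h1) (I.mul_mem_left _ h2))⟩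

/-- The involution on classes, `(a + I)* = a* + I`. -/
instance : Star I.Quotient :=
  ⟨_root_.Quotient.map (sa := I.toSubmodule.quotientRel) (sb := I.toSubmodule.quotientRel)
    star (by
      intro a b hab
      have h1 : a - b ∈ I := (Submodule.quotientRel_def _).1 hab
      refine (Submodule.quotientRel_def _).2 ?_
      rw [← star_sub]
      exact I.star_mem h1)⟩

theorem mk_mul (a b : A) : mk I (a * b) = mk I a * mk I b := rfl

theorem mk_star (a : A) : mk I (star a) = star (mk I a) := rfl

/-- The quotient `A / I` is a C⋆-algebra. -/
noncomputable instance : NonUnitalCStarAlgebra I.Quotient where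
  __ := (inferInstance : NormedAddCommGroup I.Quotient)
  __ := (inferInstance : NormedSpace ℂ I.Quotient)
  complete := CompleteSpace.complete
  left_distrib p q r := by
    obtain ⟨a, rfl⟩ := mk_surjective I p
    obtain ⟨b, rfl⟩ := mk_surjective I q
    obtain ⟨c, rfl⟩ := mk_surjective I r
    simp only [← mk_mul, ← map_add, mul_add]
  right_distrib p q r := by
    obtain ⟨a, rfl⟩ := mk_surjective I p
    obtain ⟨b, rfl⟩ := mk_surjective I q
    obtain ⟨c, rfl⟩ := mk_surjective I r
    simp only [← mk_mul, ← map_add, add_mul]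
  zero_mul p := by
    obtain ⟨a, rfl⟩ := mk_surjective I p
    rw [← map_zero (mk I), ← mk_mul, zero_mul]
  mul_zero p := by
    obtain ⟨a, rfl⟩ := mk_surjective I p
    rw [← map_zero (mk I), ← mk_mul, mul_zero]
  mul_assoc p q r := by
    obtain ⟨a, rfl⟩ := mk_surjective I p
    obtain ⟨b, rfl⟩ := mk_surjective I q
    obtain ⟨c, rfl⟩ := mk_surjective I r
    simp only [← mk_mul, mul_assoc]
  norm_mul_le p q := by
    refine le_of_forall_pos_le_add fun ε hε => ?_
    have ht : Filter.Tendsto (fun δ : ℝ => (‖p‖ + δ) * (‖q‖ + δ)) (nhdsWithin 0 (Set.Ioi 0))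
        (nhds (‖p‖ * ‖q‖)) := by
      have : Continuous fun δ : ℝ => (‖p‖ + δ) * (‖q‖ + δ) := by fun_prop
      simpa using (this.tendsto 0).mono_left nhdsWithin_le_nhds
    obtain ⟨δ, hδ, hδ0⟩ := ((ht.eventually_lt_const
      (lt_add_of_pos_right _ hε)).and self_mem_nhdsWithin).exists
    obtain ⟨a, rfl, ha⟩ := exists_rep_norm_lt I p hδ0
    obtain ⟨b, rfl, hb⟩ := exists_rep_norm_lt I q hδ0
    refine le_trans ?_ hδ.le
    rw [← mk_mul]
    exact ((norm_mk_le I _).trans (norm_mul_le a b)).trans (by gcongr)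
  star_involutive p := by
    obtain ⟨a, rfl⟩ := mk_surjective I p
    rw [← mk_star, ← mk_star, star_star]
  star_mul p q := by
    obtain ⟨a, rfl⟩ := mk_surjective I p
    obtain ⟨b, rfl⟩ := mk_surjective I q
    simp only [← mk_mul, ← mk_star, star_mul]
  star_add p q := by
    obtain ⟨a, rfl⟩ := mk_surjective I p
    obtain ⟨b, rfl⟩ := mk_surjective I q
    simp only [← map_add, ← mk_star, star_add]
  norm_mul_self_le p := by
    refine le_of_forall_pos_le_add fun ε hε => ?_
    obtain ⟨a, rfl⟩ := mk_surjective I p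
    obtain ⟨b, hb, hlt⟩ := exists_rep_norm_lt I (star (mk I a) * mk I a) (half_pos hε)
    rw [← mk_star, ← mk_mul, mk_eq_mk] at hb
    obtain ⟨y, hy, hle⟩ := I.exists_norm_sub_sq_le a hb (half_pos hε)
    have h1 : mk I a = mk I (a + y) := by
      rw [map_add, (mk_eq_zero I).2 hy, add_zero]
    have h2 : ‖mk I a‖ ≤ ‖a + y‖ := by rw [h1]; exact norm_mk_le I _
    have h3 : ‖mk I a‖ * ‖mk I a‖ ≤ ‖a + y‖ ^ 2 := by rw [← sq]; gcongr
    have h4 : star a * a + (b - star a * a) = b := by abel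
    rw [h4] at hle
    linarith
  smul_assoc c p q := by
    obtain ⟨a, rfl⟩ := mk_surjective I p
    obtain ⟨b, rfl⟩ := mk_surjective I q
    simp only [smul_eq_mul, ← map_smul, ← mk_mul, smul_mul_assoc]
  smul_comm c p q := by
    obtain ⟨a, rfl⟩ := mk_surjective I p
    obtain ⟨b, rfl⟩ := mk_surjective I q
    simp only [smul_eq_mul, ← map_smul, ← mk_mul, mul_smul_comm]
  star_smul c p := by
    obtain ⟨a, rfl⟩ := mk_surjective I p
    simp only [← map_smul, ← mk_star, star_smul]

end Quotient

end ClosedIdeal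

section PrimitiveIdeals

variable {A : Type u} [NonUnitalCStarAlgebra A]

/-- A representation of `A` on a Hilbert space is irreducible if it is nonzero and has no
closed invariant subspaces other than `0` and the whole space. -/
def IsIrreducibleRep {H : Type u} [NormedAddCommGroup H] [InnerProductSpace ℂ H] [CompleteSpace H]
    (π : A →⋆ₙₐ[ℂ] (H →L[ℂ] H)) : Prop :=
  (∃ a, π a ≠ 0) ∧
    ∀ K : Submodule ℂ H, IsClosed (K : Set H) → (∀ a, ∀ ξ ∈ K, π a ξ ∈ K) → K = ⊥ ∨ K = ⊤

/-- An ideal is primitive if it is the kernel of an irreducible representation on a Hilbert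
space. -/
def ClosedIdeal.IsPrimitive (J : ClosedIdeal A) : Prop :=
  ∃ (H : Type u) (_ : NormedAddCommGroup H) (_ : InnerProductSpace ℂ H) (_ : CompleteSpace H)
    (π : A →⋆ₙₐ[ℂ] (H →L[ℂ] H)), IsIrreducibleRep π ∧ ∀ a, a ∈ J ↔ π a = 0

variable (A) in
/-- The primitive ideal space of `A`, as a set of ideals. -/
def PrimitiveIdeals : Set (ClosedIdeal A) := {J | J.IsPrimitive}

/-- The hull of an ideal: the primitive ideals containing it. -/
def ClosedIdeal.hull (I : ClosedIdeal A) : Set (ClosedIdeal A) := {J ∈ PrimitiveIdeals A | I ≤ J}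

end PrimitiveIdeals

section GeneratorRank

variable (A : Type u) [NonUnitalCStarAlgebra A]

variable {A} in
/-- `C*(b)`, the sub-C⋆-algebra generated by a tuple (without adjoining a unit). -/
def generatedCStar {m : ℕ} (b : Fin m → A) : NonUnitalStarSubalgebra ℂ A :=
  (NonUnitalStarAlgebra.adjoin ℂ (Set.range b)).topologicalClosure

/-- Every self-adjoint `(n+1)`-tuple `a` can be approximated, for every `ε > 0` and `c ∈ A`, by a
self-adjoint tuple `b` such that `C*(b)` contains `c` up to `ε`. -/
def GenRankLE (n : ℕ) : Prop :=
  ∀ a : Fin (n + 1) → A, (∀ j, IsSelfAdjoint (a j)) → ∀ ε : ℝ, 0 < ε → ∀ c : A,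
    ∃ b : Fin (n + 1) → A, (∀ j, IsSelfAdjoint (b j)) ∧ (∀ j, ‖b j - a j‖ < ε) ∧
      ∃ d ∈ generatedCStar b, ‖c - d‖ < ε

/-- `gr₀(A)`: the smallest `n` with `GenRankLE A n`, and `∞` if there is none. -/
noncomputable def gr₀ : ℕ∞ := sInf {m : ℕ∞ | ∃ n : ℕ, m = n ∧ GenRankLE A n}

/-- `A` has a multiplicative unit. -/
def HasUnit : Prop := ∃ e : A, ∀ a : A, e * a = a ∧ a * e = a

open scoped Classical in
/-- The generator rank `gr(A) = gr₀(Ã)`, where the minimal unitization `Ã` is `A` itself if `A`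
has a unit, and the C⋆-algebra `A ⊕ ℂ1` otherwise. -/
noncomputable def gr : ℕ∞ := if HasUnit A then gr₀ A else gr₀ (Unitization ℂ A)

end GeneratorRank

/-! For separable `A` the tuples generating `A` form a Gδ subset of the complete space of
self-adjoint (n+1)-tuples, and `GenRankLE A n` says exactly that it is dense. Surjective
⋆-homomorphisms induce open continuous maps on self-adjoint tuples. If every quotient has rank at
most n, Baire therefore gives a dense set of tuples in `A` whose images generate all the quotients
simultaneously (`genRankLE_of_forall_surjective`). The reverse inequality holds because
approximations pass to quotients.

What remains is a Stone-Weierstrass theorem: a closed ⋆-subalgebra `B` mapping onto each A/I_k is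
`A` (`eq_top_of_forall_exists_sub_mem`). If x has distance δ > 0 from `B`, choose bounded b_k in `B`
with x - b_k in I_k. By convexity of m ↦ m*m, convex combinations of the elements y_k = |x - b_k|²
keep norm at least δ², so Hahn-Banach gives one positive functional bounded below on all y_k. In its
GNS representation, the closed spans of I_k H have a common nonzero vector. This vector yields
positive contractions, decreasing through the ideals, on which one state is at least 1/2. A face
argument replaces that state by a pure one, whose irreducible GNS representation vanishes on no I_k,
contradicting the covering hypothesis.

For `gr`, everything is done in the forced unitization A ⊕ ℂ1. When the algebra D is separable and
already unital, this is D ⊕ ℂ, and the extra summand does not change the rank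
(`gr₀_unitization_of_hasUnit`). -/

/-! ### Quotients, ranges and norm-controlled lifts of ⋆-homomorphisms -/

section StarHom

variable {A B : Type u} [NonUnitalCStarAlgebra A] [NonUnitalCStarAlgebra B]

/-- The quotient map `A → A / I` as a ⋆-homomorphism. -/
noncomputable def ClosedIdeal.Quotient.mkHom (I : ClosedIdeal A) : A →⋆ₙₐ[ℂ] I.Quotient where
  toFun := mk I
  map_smul' c x := (mk I).map_smul c x
  map_zero' := (mk I).map_zero
  map_add' := (mk I).map_add
  map_mul' := mk_mul I
  map_star' := mk_star I

@[simp]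
theorem ClosedIdeal.Quotient.mkHom_apply (I : ClosedIdeal A) (a : A) : mkHom I a = mk I a := rfl

/-- The kernel of a ⋆-homomorphism between C⋆-algebras. -/
def ClosedIdeal.ker (f : A →⋆ₙₐ[ℂ] B) : ClosedIdeal A where
  carrier := {a | f a = 0}
  add_mem' {x y} hx hy := by
    simp only [Set.mem_ofPred_eq] at *
    rw [map_add, hx, hy, add_zero]
  zero_mem' := map_zero f
  smul_mem' c x hx := by
    simp only [Set.mem_ofPred_eq] at *
    rw [map_smul, hx, smul_zero]
  mul_mem_left' a x hx := by
    simp only [Set.mem_ofPred_eq] at *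
    rw [map_mul, hx, mul_zero]
  mul_mem_right' a x hx := by
    simp only [Set.mem_ofPred_eq] at *
    rw [map_mul, hx, zero_mul]
  isClosed' := isClosed_eq (map_continuous f) continuous_const

@[simp]
theorem ClosedIdeal.mem_ker {f : A →⋆ₙₐ[ℂ] B} {a : A} : a ∈ ClosedIdeal.ker f ↔ f a = 0 := Iff.rfl

/-- The ⋆-homomorphism induced on the quotient by an ideal contained in the kernel. -/
noncomputable def ClosedIdeal.Quotient.lift (I : ClosedIdeal A) (f : A →⋆ₙₐ[ℂ] B)
    (h : ∀ a ∈ I, f a = 0) : I.Quotient →⋆ₙₐ[ℂ] B where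
  toFun := I.toSubmodule.liftQ (f : A →ₗ[ℂ] B) h
  map_smul' c x := map_smul _ c x
  map_zero' := map_zero _
  map_add' x y := map_add _ x y
  map_mul' x y := by
    obtain ⟨a, rfl⟩ := mk_surjective I x
    obtain ⟨b, rfl⟩ := mk_surjective I y
    exact map_mul f a b
  map_star' x := by
    obtain ⟨a, rfl⟩ := mk_surjective I x
    exact map_star f a

@[simp]
theorem ClosedIdeal.Quotient.lift_mk (I : ClosedIdeal A) (f : A →⋆ₙₐ[ℂ] B)
    (h : ∀ a ∈ I, f a = 0) (a : A) : lift I f h (mk I a) = f a := rfl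

open ClosedIdeal.Quotient in
theorem ClosedIdeal.Quotient.lift_injective (I : ClosedIdeal A) (f : A →⋆ₙₐ[ℂ] B)
    (h : ∀ a, a ∈ I ↔ f a = 0) : Function.Injective (lift I f fun a => (h a).1) := by
  rw [injective_iff_map_eq_zero]
  intro x hx
  obtain ⟨a, rfl⟩ := mk_surjective I x
  exact (mk_eq_zero I).2 ((h a).2 hx)

open ClosedIdeal.Quotient in
/-- ⋆-homomorphisms have closed range. -/
theorem isClosed_range_starHom (f : A →⋆ₙₐ[ℂ] B) : IsClosed (Set.range f) := by
  -- The induced map on the quotient by the kernel is injective, hence isometric, and has the same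
  -- range.
  have hinj := lift_injective (ClosedIdeal.ker f) f fun a => Iff.rfl
  convert! (NonUnitalStarAlgHom.isometry _ hinj).isClosedEmbedding.isClosed_range using 1
  ext y
  constructor
  · rintro ⟨a, rfl⟩
    exact ⟨mk _ a, rfl⟩
  · rintro ⟨q, rfl⟩
    obtain ⟨a, rfl⟩ := mk_surjective _ q
    exact ⟨a, rfl⟩

open ClosedIdeal.Quotient in
/-- Elements in the range of a ⋆-homomorphism lift with almost the same norm. -/
theorem exists_lift_norm_lt_starHom (f : A →⋆ₙₐ[ℂ] B) (a : A) {ε : ℝ} (hε : 0 < ε) :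
    ∃ a', f a' = f a ∧ ‖a'‖ < ‖f a‖ + ε := by
  have hinj := lift_injective (ClosedIdeal.ker f) f fun a => Iff.rfl
  have hn := NonUnitalStarAlgHom.norm_map _ hinj (mk _ a)
  rw [lift_mk] at hn
  obtain ⟨a', h1, h2⟩ := exists_rep_norm_lt (ClosedIdeal.ker f) (mk _ a) hε
  refine ⟨a', ?_, by rwa [hn]⟩
  exact congrArg (lift (ClosedIdeal.ker f) f fun a => id) h1

end StarHom

/-! ### Generating tuples as a Gδ set -/

section Generating

variable {A B : Type u} [NonUnitalCStarAlgebra A] [NonUnitalCStarAlgebra B] {m : ℕ}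

theorem isClosed_generatedCStar (b : Fin m → A) : IsClosed (generatedCStar b : Set A) :=
  NonUnitalStarSubalgebra.isClosed_topologicalClosure _

theorem mem_generatedCStar (b : Fin m → A) (j : Fin m) : b j ∈ generatedCStar b :=
  NonUnitalStarSubalgebra.le_topologicalClosure _
    (NonUnitalStarAlgebra.subset_adjoin ℂ _ ⟨j, rfl⟩)

theorem generatedCStar_le {b : Fin m → A} {S : NonUnitalStarSubalgebra ℂ A}
    (hS : IsClosed (S : Set A)) (h : ∀ j, b j ∈ S) : generatedCStar b ≤ S := by
  refine NonUnitalStarSubalgebra.topologicalClosure_minimal _ ?_ hS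
  rw [NonUnitalStarAlgebra.adjoin_le_iff]
  rintro _ ⟨j, rfl⟩
  exact h j

theorem exists_mem_adjoin_norm_sub_lt {b : Fin m → A} {c : A} {ε : ℝ}
    (h : ∃ d ∈ generatedCStar b, ‖c - d‖ < ε) :
    ∃ d ∈ NonUnitalStarAlgebra.adjoin ℂ (Set.range b), ‖c - d‖ < ε := by
  obtain ⟨d, hd, hlt⟩ := h
  obtain ⟨d', hd', hlt'⟩ := Metric.mem_closure_iff.1
    (show d ∈ closure (NonUnitalStarAlgebra.adjoin ℂ (Set.range b) : Set A) from hd)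
    (ε - ‖c - d‖) (sub_pos.2 hlt)
  refine ⟨d', hd', ?_⟩
  rw [dist_eq_norm] at hlt'
  calc ‖c - d'‖ = ‖(c - d) + (d - d')‖ := by congr 1; abel
    _ ≤ ‖c - d‖ + ‖d - d'‖ := norm_add_le _ _
    _ < ε := by linarith

theorem map_mem_generatedCStar (f : A →⋆ₙₐ[ℂ] B) {b : Fin m → A} {d : A}
    (hd : d ∈ generatedCStar b) : f d ∈ generatedCStar (fun j => f (b j)) := by
  have : generatedCStar b ≤ (generatedCStar (fun j => f (b j))).comap f := by
    refine generatedCStar_le ?_ fun j => mem_generatedCStar (fun j => f (b j)) j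
    exact (isClosed_generatedCStar _).preimage (map_continuous f)
  exact this hd

/-- An element of the algebraic span is a noncommutative ⋆-polynomial in the tuple; `p` evaluates
that polynomial at other tuples. -/
theorem exists_continuous_of_mem_adjoin {b₀ : Fin m → A} {d : A}
    (hd : d ∈ NonUnitalStarAlgebra.adjoin ℂ (Set.range b₀)) :
    ∃ p : (Fin m → A) → A, Continuous p ∧ p b₀ = d ∧
      ∀ b, p b ∈ NonUnitalStarAlgebra.adjoin ℂ (Set.range b) := by
  induction hd using NonUnitalStarAlgebra.adjoin_induction with
  | mem x hx =>
    obtain ⟨j, rfl⟩ := hx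
    exact ⟨fun b => b j, continuous_apply j, rfl, fun b =>
      NonUnitalStarAlgebra.subset_adjoin ℂ _ ⟨j, rfl⟩⟩
  | add x y _ _ hx hy =>
    obtain ⟨p, hp, rfl, hp'⟩ := hx
    obtain ⟨q, hq, rfl, hq'⟩ := hy
    exact ⟨fun b => p b + q b, hp.add hq, rfl, fun b => add_mem (hp' b) (hq' b)⟩
  | zero => exact ⟨fun _ => 0, continuous_const, rfl, fun b => zero_mem _⟩
  | mul x y _ _ hx hy =>
    obtain ⟨p, hp, rfl, hp'⟩ := hx
    obtain ⟨q, hq, rfl, hq'⟩ := hy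
    exact ⟨fun b => p b * q b, hp.mul hq, rfl, fun b => mul_mem (hp' b) (hq' b)⟩
  | smul r x _ hx =>
    obtain ⟨p, hp, rfl, hp'⟩ := hx
    exact ⟨fun b => r • p b, hp.const_smul r, rfl, fun b => SMulMemClass.smul_mem r (hp' b)⟩
  | star x _ hx =>
    obtain ⟨p, hp, rfl, hp'⟩ := hx
    exact ⟨fun b => star (p b), hp.star, rfl, fun b => star_mem (hp' b)⟩

/-- A single ⋆-polynomial witnesses the approximation, and its value moves continuously with the
tuple. -/
theorem isOpen_setOf_exists_generatedCStar (c : A) (ε : ℝ) :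
    IsOpen {b : Fin m → A | ∃ d ∈ generatedCStar b, ‖c - d‖ < ε} := by
  rw [isOpen_iff_mem_nhds]
  intro b₀ hb₀
  obtain ⟨d, hd, hlt⟩ := exists_mem_adjoin_norm_sub_lt hb₀
  obtain ⟨p, hp, rfl, hp'⟩ := exists_continuous_of_mem_adjoin hd
  have : IsOpen {b | ‖c - p b‖ < ε} := isOpen_lt (by fun_prop) continuous_const
  filter_upwards [this.mem_nhds hlt] with b hb
  exact ⟨p b, NonUnitalStarSubalgebra.le_topologicalClosure _ (hp' b), hb⟩

variable (A) in
/-- The self-adjoint `m`-tuples that generate `A` as a C⋆-algebra. -/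
def generatingTuples (m : ℕ) : Set (Fin m → selfAdjoint A) :=
  {b | generatedCStar (fun j => (b j : A)) = ⊤}

/-- Completeness makes Baire's theorem available for self-adjoint tuples. -/
instance completeSpace_selfAdjoint : CompleteSpace (selfAdjoint A) :=
  haveI : IsClosed (selfAdjoint A : Set A) := isClosed_eq continuous_star continuous_id
  this.completeSpace_coe

theorem isOpen_setOf_selfAdjoint_exists_generatedCStar (c : A) (ε : ℝ) :
    IsOpen {b : Fin m → selfAdjoint A |
      ∃ d ∈ generatedCStar (fun j => (b j : A)), ‖c - d‖ < ε} :=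
  (isOpen_setOf_exists_generatedCStar c ε).preimage
    (f := fun (b : Fin m → selfAdjoint A) j => (b j : A)) (by fun_prop)

theorem generatingTuples_eq_iInter [TopologicalSpace.SeparableSpace A] :
    generatingTuples A m = ⋂ p : ℕ × ℕ, {b | ∃ d ∈ generatedCStar (fun j => (b j : A)),
      ‖TopologicalSpace.denseSeq A p.1 - d‖ < 1 / ((p.2 : ℝ) + 1)} := by
  ext b
  simp only [generatingTuples, Set.mem_ofPred_eq, Set.mem_iInter]
  constructor
  · intro h p
    refine ⟨TopologicalSpace.denseSeq A p.1, by rw [h]; trivial, ?_⟩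
    simp only [sub_self, norm_zero]
    positivity
  · intro h
    have hsub : Set.range (TopologicalSpace.denseSeq A) ⊆
        (generatedCStar (fun j => (b j : A)) : Set A) := by
      rintro _ ⟨i, rfl⟩
      rw [← (isClosed_generatedCStar _).closure_eq, Metric.mem_closure_iff]
      intro ε hε
      obtain ⟨k, hk⟩ := exists_nat_one_div_lt hε
      obtain ⟨d, hd, hlt⟩ := h (i, k)
      exact ⟨d, hd, by rw [dist_eq_norm]; exact hlt.trans hk⟩
    rw [eq_top_iff]
    intro x _
    exact (isClosed_generatedCStar _).closure_subset_iff.2 hsub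
      (TopologicalSpace.denseRange_denseSeq A x)

theorem isGδ_generatingTuples [TopologicalSpace.SeparableSpace A] :
    IsGδ (generatingTuples A m) := by
  rw [generatingTuples_eq_iInter]
  exact .iInter_of_isOpen fun p => isOpen_setOf_selfAdjoint_exists_generatedCStar _ _

/-- The rank condition handles one element `c` and one tolerance at a time; Baire's theorem handles
a dense sequence of elements and all tolerances 1/(k+1) at once. -/
theorem GenRankLE.dense_generatingTuples [TopologicalSpace.SeparableSpace A] {n : ℕ}
    (h : GenRankLE A n) : Dense (generatingTuples A (n + 1)) := by
  rw [generatingTuples_eq_iInter]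
  refine dense_iInter_of_isOpen
    (fun p => isOpen_setOf_selfAdjoint_exists_generatedCStar _ _) fun p a => ?_
  rw [Metric.mem_closure_iff]
  intro ε hε
  have hp : 0 < 1 / ((p.2 : ℝ) + 1) := by positivity
  obtain ⟨b, hb, hlt, d, hd, hd'⟩ := h (fun j => a j) (fun j => (a j).2) (min ε (1 / (p.2 + 1)))
    (lt_min hε hp) (TopologicalSpace.denseSeq A p.1)
  refine ⟨fun j => ⟨b j, hb j⟩, ⟨d, hd, hd'.trans_le (min_le_right _ _)⟩, ?_⟩
  rw [dist_comm, dist_pi_lt_iff hε]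
  intro j
  rw [Subtype.dist_eq, dist_eq_norm]
  exact (hlt j).trans_le (min_le_left _ _)

theorem genRankLE_of_dense {n : ℕ} (h : Dense (generatingTuples A (n + 1))) : GenRankLE A n := by
  intro a ha ε hε c
  obtain ⟨b, hb, hlt⟩ := Metric.mem_closure_iff.1 (h fun j => ⟨a j, ha j⟩) ε hε
  refine ⟨fun j => b j, fun j => (b j).2, fun j => ?_, c, ?_, by simpa⟩
  · have := (dist_pi_lt_iff hε).1 hlt j
    rwa [dist_comm, Subtype.dist_eq, dist_eq_norm] at this
  · rw [show generatedCStar (fun j => (b j : A)) = ⊤ from hb]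
    trivial

/-- The map on self-adjoint tuples induced by a ⋆-homomorphism. -/
def selfAdjointTupleMap (f : A →⋆ₙₐ[ℂ] B) (m : ℕ) (b : Fin m → selfAdjoint A) :
    Fin m → selfAdjoint B := fun j => ⟨f (b j), (b j).2.map f⟩

theorem continuous_selfAdjointTupleMap (f : A →⋆ₙₐ[ℂ] B) :
    Continuous (selfAdjointTupleMap f m) := by
  have := map_continuous f
  unfold selfAdjointTupleMap
  fun_prop

/-- Small self-adjoint perturbations in `B` lift to small self-adjoint perturbations in `A`; this is
what keeps preimages of dense sets dense. -/
theorem isOpenMap_selfAdjointTupleMap (f : A →⋆ₙₐ[ℂ] B) (hf : Function.Surjective f) :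
    IsOpenMap (selfAdjointTupleMap f m) := by
  rw [isOpenMap_iff_nhds_le]
  intro b s hs
  obtain ⟨ε, hε, hs⟩ := Metric.mem_nhds_iff.1 (Filter.mem_map.1 hs)
  rw [Metric.mem_nhds_iff]
  refine ⟨ε / 2, half_pos hε, fun c hc => ?_⟩
  have hc' : ∀ j, ‖(c j : B) - f (b j)‖ < ε / 2 := by
    intro j
    have := (dist_pi_lt_iff (half_pos hε)).1 hc j
    rwa [Subtype.dist_eq, dist_eq_norm] at this
  have hx : ∀ j, ∃ x : A, f x = c j - f (b j) ∧ ‖x‖ < ε := by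
    intro j
    obtain ⟨x, hx⟩ := hf (c j - f (b j))
    obtain ⟨y, hy, hlt⟩ := exists_lift_norm_lt_starHom f x (half_pos hε)
    rw [hx] at hy hlt
    exact ⟨y, hy, by linarith [hc' j]⟩
  choose x hx hlt using hx
  have hsa : ∀ j, IsSelfAdjoint (c j - f (b j) : B) := fun j => (c j).2.sub ((b j).2.map f)
  -- The differences are self-adjoint, so the real parts of their lifts are again lifts, of no
  -- larger norm.
  have key : selfAdjointTupleMap f m (fun j => b j + realPart (x j)) = c := by
    funext j
    ext
    have h1 : star (f (x j)) = f (x j) := by rw [hx]; exact (hsa j).star_eq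
    simp only [selfAdjointTupleMap, AddSubgroup.coe_add, realPart_apply_coe, map_add]
    rw [← Complex.coe_smul, map_smul, map_add, map_star, h1, hx, ← two_smul ℂ, smul_smul]
    simp
  rw [← key]
  refine hs ?_
  rw [Metric.mem_ball, dist_pi_lt_iff hε]
  intro j
  rw [dist_eq_norm, add_sub_cancel_left]
  exact (realPart.norm_le (x j)).trans_lt (hlt j)

end Generating

/-! ### Passing the rank condition to and from quotients -/

section GenRank

variable {A B : Type u} [NonUnitalCStarAlgebra A] [NonUnitalCStarAlgebra B]

theorem GenRankLE.of_surjective {n : ℕ} (h : GenRankLE A n) (f : A →⋆ₙₐ[ℂ] B)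
    (hf : Function.Surjective f) : GenRankLE B n := by
  intro a ha ε hε c
  have hs : Function.Surjective (selfAdjointTupleMap f (n + 1)) := by
    intro b
    choose x hx using fun j => hf (b j)
    refine ⟨fun j => realPart (x j), ?_⟩
    funext j
    ext
    have h1 : star (f (x j)) = f (x j) := by rw [hx]; exact (b j).2.star_eq
    simp only [selfAdjointTupleMap, realPart_apply_coe]
    rw [← Complex.coe_smul, map_smul, map_add, map_star, h1, hx, ← two_smul ℂ, smul_smul]
    simp
  obtain ⟨a', ha'⟩ := hs fun j => ⟨a j, ha j⟩
  obtain ⟨c', rfl⟩ := hf c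
  obtain ⟨b, hb, hlt, d, hd, hd'⟩ := h (fun j => a' j) (fun j => (a' j).2) ε hε c'
  refine ⟨fun j => f (b j), fun j => (hb j).map f, fun j => ?_, f d,
    map_mem_generatedCStar f hd, ?_⟩
  · have : a j = f (a' j) := congrArg Subtype.val (congrFun ha' j).symm
    rw [this, ← map_sub]
    exact (NonUnitalStarAlgHom.norm_apply_le f _).trans_lt (hlt j)
  · rw [← map_sub]
    exact (NonUnitalStarAlgHom.norm_apply_le f _).trans_lt hd'

/-- Leaving the additional entry unperturbed can only enlarge the generated algebra. Monotonicity in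
n is what turns the infimum `gr₀` into `GenRankLE`. -/
theorem GenRankLE.succ {n : ℕ} (h : GenRankLE A n) : GenRankLE A (n + 1) := by
  intro a ha ε hε c
  obtain ⟨b, hb, hlt, d, hd, hd'⟩ := h (fun j => a j.castSucc) (fun j => ha _) ε hε c
  refine ⟨Fin.snoc b (a (Fin.last _)), ?_, ?_, d, ?_, hd'⟩
  · intro j
    refine Fin.lastCases ?_ (fun i => ?_) j
    · rw [Fin.snoc_last]; exact ha _
    · rw [Fin.snoc_castSucc]; exact hb i
  · intro j
    refine Fin.lastCases ?_ (fun i => ?_) j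
    · rw [Fin.snoc_last]; simpa
    · rw [Fin.snoc_castSucc]; exact hlt i
  · refine generatedCStar_le (isClosed_generatedCStar _) (fun j => ?_) hd
    have := mem_generatedCStar (Fin.snoc b (a (Fin.last _)) : Fin (n + 2) → A) j.castSucc
    rwa [Fin.snoc_castSucc] at this

theorem GenRankLE.mono {n k : ℕ} (h : GenRankLE A n) (hnk : n ≤ k) : GenRankLE A k := by
  induction hnk with
  | refl => exact h
  | step _ ih => exact ih.succ

theorem gr₀_le_iff {n : ℕ} : gr₀ A ≤ n ↔ GenRankLE A n := by
  refine ⟨fun h => ?_, fun h => sInf_le ⟨n, rfl, h⟩⟩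
  have hlt : gr₀ A < ((n + 1 : ℕ) : ℕ∞) := h.trans_lt (by exact_mod_cast n.lt_succ_self)
  obtain ⟨_, ⟨k, rfl, hk⟩, hlt⟩ := sInf_lt_iff.1 hlt
  exact hk.mono (Nat.lt_succ_iff.1 (by exact_mod_cast hlt))

theorem ENat.le_of_forall_le_natCast {x y : ℕ∞} (h : ∀ n : ℕ, y ≤ n → x ≤ n) : x ≤ y := by
  induction y using ENat.recTopCoe with
  | top => exact le_top
  | coe n => exact h n le_rfl

theorem gr₀_eq_iSup_of_forall_genRankLE_iff {B : ℕ → Type u} [∀ k, NonUnitalCStarAlgebra (B k)]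
    (h : ∀ n, GenRankLE A n ↔ ∀ k, GenRankLE (B k) n) : gr₀ A = ⨆ k, gr₀ (B k) := by
  have h' (n : ℕ) : gr₀ A ≤ n ↔ ⨆ k, gr₀ (B k) ≤ n := by
    simp only [iSup_le_iff, gr₀_le_iff, h]
  exact le_antisymm (ENat.le_of_forall_le_natCast fun n => (h' n).2)
    (ENat.le_of_forall_le_natCast fun n => (h' n).1)

theorem gr₀_eq_of_forall_genRankLE_iff (h : ∀ n, GenRankLE A n ↔ GenRankLE B n) :
    gr₀ A = gr₀ B := by
  simp only [gr₀, h]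

/-- Suppose that a closed ⋆-subalgebra of `A` that maps onto each of countably many quotients
is all of `A`. Then the generator rank of `A` is at most `n` if that of every quotient is. -/
theorem genRankLE_of_forall_surjective [TopologicalSpace.SeparableSpace A] {B : ℕ → Type u}
    [∀ k, NonUnitalCStarAlgebra (B k)] (f : ∀ k, A →⋆ₙₐ[ℂ] B k)
    (hf : ∀ k, Function.Surjective (f k))
    (hsub : ∀ S : NonUnitalStarSubalgebra ℂ A, IsClosed (S : Set A) →
      (∀ k x, ∃ y ∈ S, f k y = x) → S = ⊤) {n : ℕ} (h : ∀ k, GenRankLE (B k) n) :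
    GenRankLE A n := by
  have hsep (k : ℕ) : TopologicalSpace.SeparableSpace (B k) :=
    (hf k).denseRange.separableSpace (map_continuous (f k))
  -- Baire: the tuples whose image generates every `B k` form a countable intersection of dense Gδ
  -- sets.
  refine genRankLE_of_dense (Dense.mono ?_ (dense_iInter_of_Gδ
    (f := fun k => selfAdjointTupleMap (f k) (n + 1) ⁻¹' generatingTuples (B k) (n + 1))
    (fun k => isGδ_generatingTuples.preimage (continuous_selfAdjointTupleMap (f k)))
    fun k => (h k).dense_generatingTuples.preimage (isOpenMap_selfAdjointTupleMap (f k) (hf k))))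
  intro b hb
  refine hsub _ (isClosed_generatedCStar _) fun k x => ?_
  have hk : generatedCStar (fun j => f k (b j)) = ⊤ := Set.mem_iInter.1 hb k
  have := isClosed_generatedCStar (fun j => (b j : A))
  let g := (f k).comp (NonUnitalStarSubalgebraClass.subtype (generatedCStar fun j => (b j : A)))
  -- The image of the generated subalgebra is closed and contains the generators of `B k`, so it is
  -- all of `B k`.
  have hle : generatedCStar (fun j => f k (b j)) ≤ NonUnitalStarAlgHom.range g := by
    refine generatedCStar_le (by simpa using isClosed_range_starHom g) fun j => ?_
    exact ⟨⟨b j, mem_generatedCStar (fun j => (b j : A)) j⟩, rfl⟩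
  obtain ⟨y, hy⟩ := hle (show x ∈ generatedCStar (fun j => f k (b j)) by rw [hk]; trivial)
  exact ⟨y, y.2, hy⟩

end GenRank

/-! ### The forced unitization of a unital algebra -/

section UnitizationOfUnital

variable {D : Type u} [NonUnitalCStarAlgebra D]

theorem isSelfAdjoint_of_forall_mul {e : D} (he : ∀ a : D, e * a = a ∧ a * e = a) :
    IsSelfAdjoint e := by
  have h1 : star e * e = star e := (he _).2
  have h2 := congrArg star h1
  rw [star_mul, star_star, h1] at h2
  exact h2

/-- For `D` with unit `e`, the ⋆-homomorphism `D⁺¹ → D` that restricts to the identity. -/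
def unitizationProj (e : D) (he : ∀ a : D, e * a = a ∧ a * e = a) :
    Unitization ℂ D →⋆ₙₐ[ℂ] D where
  toFun x := x.snd + x.fst • e
  map_smul' c x := by simp [smul_smul]
  map_zero' := by simp
  map_add' x y := by
    simp only [Unitization.snd_add, Unitization.fst_add, add_smul]
    abel
  map_mul' x y := by
    simp only [Unitization.snd_mul, Unitization.fst_mul, mul_add, add_mul, smul_mul_assoc,
      mul_smul_comm, (he _).1, (he _).2, smul_add, smul_smul, mul_comm x.fst y.fst]
    abel
  map_star' x := by
    simp [(isSelfAdjoint_of_forall_mul he).star_eq]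

theorem unitizationProj_apply (e : D) (he : ∀ a : D, e * a = a ∧ a * e = a) (x : D⁺¹) :
    unitizationProj e he x = x.snd + x.fst • e := rfl

@[simp]
theorem unitizationProj_inr (e : D) (he : ∀ a : D, e * a = a ∧ a * e = a) (d : D) :
    unitizationProj e he (d : D⁺¹) = d := by
  simp [unitizationProj_apply]

theorem inr_unitizationProj_add (e : D) (he : ∀ a : D, e * a = a ∧ a * e = a) (x : D⁺¹) :
    ((unitizationProj e he x : D) : D⁺¹) + x.fst • (1 - (e : D⁺¹)) = x := by
  ext <;> simp [unitizationProj_apply, sub_eq_add_neg]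

theorem unitizationProj_surjective (e : D) (he : ∀ a : D, e * a = a ∧ a * e = a) :
    Function.Surjective (unitizationProj e he) := fun d => ⟨d, unitizationProj_inr e he d⟩

/-- For `D` with unit `e`, tuples `b` and `b - t e` that both generate `D` give a tuple
generating `D⁺¹ ≅ D ⊕ ℂ`, as soon as some `t j` is nonzero. -/
theorem generatedCStar_unitization_eq_top {e : D} (he : ∀ a : D, e * a = a ∧ a * e = a) {m : ℕ}
    {b : Fin m → D} {t : Fin m → ℝ} (j₀ : Fin m) (ht : t j₀ ≠ 0) (hb : generatedCStar b = ⊤)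
    (hbt : generatedCStar (fun j => b j - (t j : ℂ) • e) = ⊤) :
    generatedCStar (fun j => (b j : D⁺¹) + (t j : ℂ) • (1 - (e : D⁺¹))) = ⊤ := by
  set g : Fin m → D⁺¹ := fun j => (b j : D⁺¹) + (t j : ℂ) • (1 - (e : D⁺¹)) with hg
  set C := generatedCStar g with hC
  set q : D⁺¹ := 1 - (e : D⁺¹) with hq
  have hqq : q * q = q := by
    have : (e : D⁺¹) * e = e := by rw [← Unitization.inr_mul, (he e).1]
    rw [hq, sub_mul, mul_sub, mul_sub, this]
    simp
  have hdq (d : D) : (d : D⁺¹) * q = 0 := by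
    rw [hq, mul_sub, mul_one, ← Unitization.inr_mul, (he d).2, sub_self]
  have hqd (d : D) : q * (d : D⁺¹) = 0 := by
    rw [hq, sub_mul, one_mul, ← Unitization.inr_mul, (he d).1, sub_self]
  have hcl : IsClosed (C : Set D⁺¹) := isClosed_generatedCStar _
  have hgC (j) : g j ∈ C := mem_generatedCStar g j
  -- `C` projects onto `D`, since its image is closed and contains `b`; so each d lies in `C` up to
  -- a multiple of the complementary projection `q`.
  have hlift (d : D) : ∃ s : ℂ, (d : D⁺¹) + s • q ∈ C := by
    let p := (unitizationProj e he).comp (NonUnitalStarSubalgebraClass.subtype C)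
    have hle : generatedCStar b ≤ NonUnitalStarAlgHom.range p := by
      refine generatedCStar_le (by simpa using isClosed_range_starHom p) fun j => ?_
      refine ⟨⟨g j, hgC j⟩, ?_⟩
      change unitizationProj e he (g j) = b j
      rw [hg, map_add, unitizationProj_inr, map_smul]
      simp [unitizationProj_apply, sub_eq_add_neg, hq]
    obtain ⟨c, hc⟩ := hle (show d ∈ generatedCStar b by rw [hb]; trivial)
    refine ⟨(c : D⁺¹).fst, ?_⟩
    have h1 : unitizationProj e he c = d := hc
    rw [← h1, inr_unitizationProj_add]
    exact c.2
  -- it suffices to find the projection `q` in the subalgebra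
  suffices hqC : q ∈ C by
    rw [eq_top_iff]
    intro x _
    rw [← inr_unitizationProj_add e he x]
    obtain ⟨s, hs⟩ := hlift (unitizationProj e he x)
    have := add_mem hs (SMulMemClass.smul_mem (x.fst - s) hqC)
    rwa [add_assoc, ← add_smul, add_sub_cancel] at this
  have hsmul {s : ℂ} (hs : s ≠ 0) (h : s • q ∈ C) : q ∈ C := by
    have := SMulMemClass.smul_mem s⁻¹ h
    rwa [smul_smul, inv_mul_cancel₀ hs, one_smul] at this
  have hzero (h : (e : D⁺¹) ∈ C) : q ∈ C := by
    refine hsmul (s := t j₀) (by exact_mod_cast ht) ?_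
    have := sub_mem (hgC j₀) (mul_mem (hgC j₀) h)
    simp only [hg, add_mul, smul_mul_assoc, hqd, ← Unitization.inr_mul, (he _).2, smul_zero,
      add_zero, add_sub_cancel_left] at this
    exact this
  -- Since e + s q lies in `C`, so does its square minus itself, (s² - s) q; this settles s ≠ 0, 1.
  -- If s = 0 then `e` is in `C`. If s = 1 then `C` contains the unit, hence every b_j - t_j e;
  -- these generate `D`, so again `e` is in `C`.
  obtain ⟨s, hs⟩ := hlift e
  by_cases h0 : s = 0
  · refine hzero ?_
    simpa [h0] using hs
  by_cases h1 : s = 1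
  · refine hzero ?_
    have hle : generatedCStar (fun j => b j - (t j : ℂ) • e) ≤
        C.comap (Unitization.inrNonUnitalStarAlgHom ℂ D) := by
      refine generatedCStar_le (hcl.preimage Unitization.isometry_inr.continuous) fun j => ?_
      change ((b j - (t j : ℂ) • e : D) : D⁺¹) ∈ C
      have := sub_mem (hgC j) (SMulMemClass.smul_mem (t j : ℂ) hs)
      simp only [hg, h1, one_smul, smul_add] at this
      convert! this using 1
      simp only [Unitization.inr_sub, Unitization.inr_smul]
      abel
    exact hle (show e ∈ generatedCStar _ by rw [hbt]; trivial)
  · refine hsmul (s := s * s - s) ?_ ?_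
    · rw [← mul_sub_one]
      exact mul_ne_zero h0 (sub_ne_zero.2 h1)
    · have := sub_mem (mul_mem hs hs) hs
      simp only [mul_add, add_mul, smul_mul_assoc, mul_smul_comm, hqd, hdq, hqq, smul_zero,
        add_zero, zero_add, ← Unitization.inr_mul, (he e).1, add_sub_add_left_eq_sub, smul_smul,
        ← sub_smul] at this
      exact this

/-- In D ⊕ ℂ, perturb the scalar coordinates to nonzero reals `t`, then the `D`-coordinates to `b`
with both `b` and `b - t e` generating. Such `b` are dense, as the intersection of a dense Gδ set
with a translate of itself. -/
theorem GenRankLE.unitization_of_hasUnit [TopologicalSpace.SeparableSpace D] (hu : HasUnit D)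
    {n : ℕ} (h : GenRankLE D n) : GenRankLE (Unitization ℂ D) n := by
  obtain ⟨e, he⟩ := hu
  have hesa := isSelfAdjoint_of_forall_mul he
  refine genRankLE_of_dense fun a => Metric.mem_closure_iff.2 fun ε hε => ?_
  set q : D⁺¹ := 1 - (e : D⁺¹) with hq
  set K : ℝ := 1 + ‖q‖ with hK
  have hKpos : 0 < K := by positivity
  have hδ : 0 < ε / K := by positivity
  have hqsa : IsSelfAdjoint q := (IsSelfAdjoint.one _).sub (hesa.inr ℂ)
  have ht : ∀ j, ∃ s : ℝ, s ≠ 0 ∧ |s - (a j : D⁺¹).fst.re| < ε / K := by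
    intro j
    obtain ⟨s, hs, hs'⟩ := Metric.mem_closure_iff.1
      (dense_compl_singleton (0 : ℝ) (a j : D⁺¹).fst.re) _ hδ
    exact ⟨s, hs, by rwa [dist_comm, Real.dist_eq] at hs'⟩
  choose t ht0 ht using ht
  let te : Fin (n + 1) → selfAdjoint D := fun j => t j • ⟨e, hesa⟩
  have hdense := h.dense_generatingTuples.inter_of_Gδ isGδ_generatingTuples
    (isGδ_generatingTuples.preimage (Homeomorph.subRight te).continuous)
    (h.dense_generatingTuples.preimage (Homeomorph.subRight te).isOpenMap)
  obtain ⟨b, ⟨hb, hb'⟩, hlt⟩ := Metric.mem_closure_iff.1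
    (hdense (selfAdjointTupleMap (unitizationProj e he) (n + 1) a)) _ hδ
  have hbt : generatedCStar (fun j => (b j : D) - (t j : ℂ) • e) = ⊤ := by
    simpa [generatingTuples, te] using! hb'
  refine ⟨fun j => ⟨(b j : D⁺¹) + (t j : ℂ) • q, ((b j).2.inr ℂ).add (IsSelfAdjoint.smul (Complex.conj_ofReal _) hqsa)⟩,
    generatedCStar_unitization_eq_top he 0 (ht0 0) hb hbt, ?_⟩
  rw [dist_comm, dist_pi_lt_iff hε]
  intro j
  rw [dist_comm] at hlt
  have h1 := (dist_pi_lt_iff hδ).1 hlt j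
  rw [Subtype.dist_eq, dist_eq_norm] at h1 ⊢
  have h2 : (((a j : D⁺¹).fst.re : ℝ) : ℂ) = (a j : D⁺¹).fst := by
    have := congrArg (fun x : D⁺¹ => x.fst) (a j).2.star_eq
    simp only [Unitization.fst_star] at this
    exact Complex.conj_eq_iff_re.1 this
  have h3 : (b j : D⁺¹) + (t j : ℂ) • q - (a j : D⁺¹) =
      (((b j : D) - unitizationProj e he (a j) : D) : D⁺¹) +
        ((t j - (a j : D⁺¹).fst.re : ℝ) : ℂ) • q := by
    conv_lhs => rw [← inr_unitizationProj_add e he (a j : D⁺¹)]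
    rw [Complex.ofReal_sub, h2, Unitization.inr_sub, sub_smul]
    abel
  calc ‖(b j : D⁺¹) + (t j : ℂ) • q - (a j : D⁺¹)‖
      ≤ ‖(b j : D) - unitizationProj e he (a j)‖ + |t j - (a j : D⁺¹).fst.re| * ‖q‖ := by
        rw [h3]
        refine (norm_add_le _ _).trans_eq ?_
        rw [Unitization.norm_inr, norm_smul, Complex.norm_real, Real.norm_eq_abs]
    _ < ε / K + ε / K * ‖q‖ := add_lt_add_of_lt_of_le h1 (by gcongr; exact (ht j).le)
    _ = ε := by rw [hK]; field_simp

theorem gr₀_unitization_of_hasUnit [TopologicalSpace.SeparableSpace D] (hu : HasUnit D) :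
    gr₀ (Unitization ℂ D) = gr₀ D := by
  obtain ⟨e, he⟩ := hu
  exact gr₀_eq_of_forall_genRankLE_iff fun n =>
    ⟨fun h => h.of_surjective _ (unitizationProj_surjective e he),
      fun h => h.unitization_of_hasUnit ⟨e, he⟩⟩

end UnitizationOfUnital

/-! ### Extreme points and decreasing sequences of affine functions -/

section ExtremePoints

variable {E : Type*} [AddCommGroup E] [Module ℝ E] [TopologicalSpace E] [T2Space E]
  [IsTopologicalAddGroup E]

/-- A decreasing sequence of continuous affine functions that is bounded below at some point of a
compact set has the same lower bound at some extreme point. -/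
theorem exists_mem_extremePoints_forall_le (_ : ContinuousSMul ℝ E)
    (_ : LocallyConvexSpace ℝ E) {S : Set E} (hS : IsCompact S)
    {g : ℕ → E → ℝ} (hg : ∀ k, Continuous (g k))
    (hadd : ∀ k x y, g k (x + y) = g k x + g k y) (hsmul : ∀ k (t : ℝ) x, g k (t • x) = t * g k x)
    (hanti : ∀ x ∈ S, Antitone fun k => g k x) (hnonneg : ∀ k, ∀ x ∈ S, 0 ≤ g k x)
    {c : ℝ} {x₀ : E} (hx₀ : x₀ ∈ S) (hc : ∀ k, c ≤ g k x₀) :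
    ∃ x ∈ S.extremePoints ℝ, ∀ k, c ≤ g k x := by
  have hbdd : ∀ x ∈ S, BddBelow (Set.range fun k => g k x) := fun x hx =>
    ⟨0, by rintro _ ⟨k, rfl⟩; exact hnonneg k x hx⟩
  -- The infimum of the `g k` is upper semicontinuous and attains its maximum `M` on `S`; the points
  -- where it equals `M` form a compact extreme subset `F`, to which Krein-Milman applies.
  obtain ⟨z, hz, hmax⟩ := UpperSemicontinuousOn.exists_isMaxOn ⟨x₀, hx₀⟩ hS
    (upperSemicontinuousOn_ciInf hbdd fun k => (hg k).upperSemicontinuous.upperSemicontinuousOn S)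
  set M : ℝ := ⨅ k, g k z with hM
  have hle {x : E} (hx : x ∈ S) : ⨅ k, g k x ≤ M := hmax hx
  have hcM : c ≤ M := (le_ciInf hc).trans (hle hx₀)
  set F : Set E := S ∩ ⋂ k, {x | M ≤ g k x} with hF
  have hFS : F ⊆ S := Set.inter_subset_left
  have hFc : IsCompact F := hS.inter_right
    (isClosed_iInter fun k => isClosed_le continuous_const (hg k))
  have hFne : F.Nonempty := ⟨z, hz, Set.mem_iInter.2 fun k => ciInf_le (hbdd z hz) k⟩
  obtain ⟨w, hw⟩ := hFc.extremePoints_nonempty hFne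
  have hext : IsExtreme ℝ S F := by
    refine ⟨hFS, ?_⟩
    rintro x hx y hy v hv ⟨s, t, hs, ht, hst, rfl⟩
    refine ⟨hx, Set.mem_iInter.2 fun k => ?_⟩
    by_contra hlt
    simp only [Set.mem_ofPred_eq, not_le] at hlt
    -- The slack is chosen so that s · g_k(x) + t · (M + slack) = M; a strict gain at y then
    -- contradicts the bound `M` at s x + t y for the index max(k, l).
    have hη : 0 < s * (M - g k x) / t := by
      have := sub_pos.2 hlt
      positivity
    obtain ⟨l, hl⟩ := exists_lt_of_ciInf_lt
      ((hle hy).trans_lt (lt_add_of_pos_right M hη))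
    have h1 := Set.mem_iInter.1 hv.2 (max k l)
    simp only [Set.mem_ofPred_eq, hadd, hsmul] at h1
    have h2 : g (max k l) x ≤ g k x := hanti x hx (le_max_left _ _)
    have h3 : g (max k l) y < M + s * (M - g k x) / t :=
      (hanti y hy (le_max_right _ _)).trans_lt hl
    have h4 : t * g (max k l) y < t * M + s * (M - g k x) := by
      calc _ < t * (M + s * (M - g k x) / t) := by gcongr
        _ = _ := by field_simp
    have h5 : s * g (max k l) x ≤ s * g k x := by gcongr
    have h6 : s * M + t * M = M := by rw [← add_mul, hst, one_mul]
    nlinarith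
  exact ⟨w, hext.extremePoints_subset_extremePoints hw,
    fun k => hcM.trans (Set.mem_iInter.1 hw.1.2 k)⟩

end ExtremePoints

/-! ### Weak-⋆ compactness of the state space -/

section States

variable (U : Type u) [CStarAlgebra U] [PartialOrder U] [StarOrderedRing U]

open scoped ComplexOrder

/-- The state space of a unital C⋆-algebra. -/
def stateSpace : Set (WeakDual ℂ U) := {ψ | ψ 1 = 1 ∧ ∀ a, 0 ≤ a → 0 ≤ ψ a}

/-- Banach-Alaoglu; the crude radius 4 comes from writing an element as a combination of four
positive elements of no larger norm. -/
theorem isCompact_stateSpace : IsCompact (stateSpace U) := by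
  refine (WeakDual.isCompact_closedBall (𝕜 := ℂ) (0 : StrongDual ℂ U) 4).of_isClosed_subset ?_ ?_
  · have : stateSpace U = {ψ | ψ 1 = 1} ∩ ⋂ a : U, ⋂ _ : 0 ≤ a, {ψ | 0 ≤ ψ a} := by
      ext ψ; simp [stateSpace]
    rw [this]
    refine (isClosed_eq (WeakDual.eval_continuous _) continuous_const).inter ?_
    exact isClosed_iInter fun a => isClosed_iInter fun _ =>
      isClosed_Ici.preimage (WeakDual.eval_continuous a)
  · rintro ψ ⟨h1, h2⟩
    simp only [Set.mem_preimage, mem_closedBall_zero_iff]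
    refine ContinuousLinearMap.opNorm_le_bound _ (by norm_num) fun x => ?_
    have hb (a : U) (ha : 0 ≤ a) : ‖ψ a‖ ≤ ‖a‖ := by
      have := (PositiveLinearMap.mk₀ ((WeakDual.toStrongDual ψ : StrongDual ℂ U) : U →ₗ[ℂ] ℂ)
        h2).norm_apply_le_of_nonneg a ha
      have h1' : ‖ψ 1‖ = 1 := by rw [h1, norm_one]
      calc ‖ψ a‖ ≤ ‖ψ 1‖ * ‖a‖ := this
        _ = ‖a‖ := by rw [h1', one_mul]
    obtain ⟨y, hy0, hyn, hy⟩ := CStarAlgebra.exists_sum_four_nonneg x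
    calc ‖ψ x‖ = ‖∑ i : Fin 4, Complex.I ^ (i : ℕ) • ψ (y i)‖ := by
          conv_lhs => rw [hy]
          simp only [map_sum, map_smul]
      _ ≤ ∑ i : Fin 4, ‖x‖ := by
          refine (norm_sum_le _ _).trans (Finset.sum_le_sum fun i _ => ?_)
          rw [norm_smul, norm_pow, Complex.norm_I, one_pow, one_mul]
          exact (hb _ (hy0 i)).trans (hyn i)
      _ = 4 * ‖x‖ := by simp

end States

/-! ### Separation by a positive functional -/

section HahnBanach

variable {U : Type u} [CStarAlgebra U] [PartialOrder U] [StarOrderedRing U]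

open scoped ComplexOrder

/-- A convex set of positive elements that is bounded away from zero in norm is bounded away from
zero by a positive functional. -/
theorem exists_positiveLinearMap_forall_le {T : Set U} (hT : Convex ℝ T) (hpos : ∀ w ∈ T, 0 ≤ w)
    {ε : ℝ} (hε : 0 < ε) (hle : ∀ w ∈ T, ε ≤ ‖w‖) :
    ∃ f : U →ₚ[ℂ] ℂ, ∃ c : ℝ, 0 < c ∧ ∀ w ∈ T, c ≤ (f w).re := by
  -- Adding `p` makes `s` stable under subtracting positive elements, and only the real part is
  -- constrained. Being bounded above on `s` thus forces Re f(p) ≥ 0 along -t p and Im f(p) = 0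
  -- along the imaginary multiples of p.
  set s : Set U := {v | ∃ p : U, 0 ≤ p ∧ ‖(realPart v : U) + p‖ < ε} with hs
  have hopen : IsOpen s := by
    have : s = ⋃ p : U, ⋃ _ : 0 ≤ p, {v : U | ‖(realPart v : U) + p‖ < ε} := by
      ext v; simp [hs]
    rw [this]
    refine isOpen_iUnion fun p => isOpen_iUnion fun _ => isOpen_lt ?_ continuous_const
    simp only [realPart_apply_coe]
    fun_prop
  have hconv : Convex ℝ s := by
    rintro v ⟨p, hp, hv⟩ w ⟨q, hq, hw⟩ a b ha hb hab
    refine ⟨a • p + b • q, add_nonneg (smul_nonneg ha hp) (smul_nonneg hb hq), ?_⟩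
    have h1 : ((realPart (a • v + b • w) : selfAdjoint U) : U) + (a • p + b • q) =
        a • ((realPart v : U) + p) + b • ((realPart w : U) + q) := by
      simp only [map_add, map_smul, selfAdjoint.val_smul, AddSubgroup.coe_add, smul_add]
      abel
    rw [h1]
    have := convex_ball (0 : U) ε (mem_ball_zero_iff.2 hv) (mem_ball_zero_iff.2 hw) ha hb hab
    exact mem_ball_zero_iff.1 this
  have hdisj : Disjoint s T := by
    rw [Set.disjoint_left]
    rintro w ⟨p, hp, hlt⟩ hw
    have hw0 := hpos w hw
    rw [hw0.isSelfAdjoint.coe_realPart] at hlt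
    exact ((hle w hw).trans (CStarAlgebra.norm_le_norm_of_nonneg_of_le hw0
      (le_add_of_nonneg_right hp))).not_gt hlt
  obtain ⟨f, c, hfs, hfT⟩ := RCLike.geometric_hahn_banach_open (𝕜 := ℂ) hconv hopen hT hdisj
  have hc : 0 < c := by
    simpa using hfs 0 ⟨0, le_rfl, by simpa using hε⟩
  have hbound {x : ℝ} (h : ∀ t : ℝ, 0 ≤ t → t * x < c) : x ≤ 0 := by
    by_contra! hx
    have := h (c / x) (by positivity)
    rw [div_mul_cancel₀ _ hx.ne'] at this
    exact this.false
  have hre (p : U) (hp : 0 ≤ p) : 0 ≤ (f p).re := by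
    have := hbound (x := -(f p).re) fun t ht => by
      have h1 := hfs (-(t • p)) ⟨t • p, smul_nonneg ht hp, by
        rw [(smul_nonneg ht hp).isSelfAdjoint.neg.coe_realPart, neg_add_cancel, norm_zero]
        exact hε⟩
      rw [map_neg, ← Complex.coe_smul, map_smul] at h1
      simpa using h1
    linarith
  have him (p : U) (hp : 0 ≤ p) : (f p).im = 0 := by
    have key (r : ℝ) : r * (f p).im < c := by
      have h1 := hfs ((-(r : ℂ) * Complex.I) • p) ⟨0, le_rfl, by
        rw [mul_smul, neg_smul, Complex.coe_smul, map_neg, map_smul, realPart_I_smul,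
          hp.isSelfAdjoint.imaginaryPart]
        simpa using hε⟩
      rw [map_smul] at h1
      simpa using h1
    refine le_antisymm (hbound fun t _ => key t) ?_
    have := hbound (x := -(f p).im) fun t _ => by simpa using key (-t)
    linarith
  refine ⟨PositiveLinearMap.mk₀ (f : U →ₗ[ℂ] ℂ) fun p hp => ?_, c, hc, fun w hw => hfT w hw⟩
  exact Complex.nonneg_iff.2 ⟨hre p hp, (him p hp).symm⟩

end HahnBanach

/-! ### The GNS construction -/

section GNS

variable {U : Type u} [CStarAlgebra U] [PartialOrder U] [StarOrderedRing U]

open scoped ComplexOrder InnerProductSpace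

/-- The GNS representation, with its cyclic vector. -/
theorem PositiveLinearMap.exists_cyclic_rep (f : U →ₚ[ℂ] ℂ) :
    ∃ (H : Type u) (_ : NormedAddCommGroup H) (_ : InnerProductSpace ℂ H) (_ : CompleteSpace H)
      (π : U →⋆ₐ[ℂ] (H →L[ℂ] H)) (ξ : H), (∀ a, ⟪ξ, π a ξ⟫_ℂ = f a) ∧
        DenseRange fun a => π a ξ := by
  have h (a : U) : f.gnsStarAlgHom a (f.toPreGNS 1 : f.PreGNS) = (f.toPreGNS a : f.PreGNS) := by
    change f.gnsNonUnitalStarAlgHom a (f.toPreGNS 1 : f.PreGNS) = _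
    rw [PositiveLinearMap.gnsNonUnitalStarAlgHom_apply_coe]
    simp
  refine ⟨f.GNS, inferInstance, inferInstance, inferInstance, f.gnsStarAlgHom,
    (f.toPreGNS 1 : f.PreGNS), fun a => ?_, ?_⟩
  · rw [h, UniformSpace.Completion.inner_coe, PositiveLinearMap.preGNS_inner_def]
    simp
  · simp only [h]
    exact UniformSpace.Completion.denseRange_coe.comp f.toPreGNS.surjective.denseRange
      (UniformSpace.Completion.continuous_coe _)

end GNS

/-! ### Pure states give irreducible representations -/

section VectorStates

variable {U : Type u} [CStarAlgebra U]
  {H : Type u} [NormedAddCommGroup H] [InnerProductSpace ℂ H] [CompleteSpace H]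

open scoped ComplexOrder InnerProductSpace

theorem inner_map_star_mul (π : U →⋆ₐ[ℂ] (H →L[ℂ] H)) (a b : U) (v w : H) :
    ⟪v, π (star a * b) w⟫_ℂ = ⟪π a v, π b w⟫_ℂ := by
  rw [map_mul, map_star, mul_apply_eq_comp, ContinuousLinearMap.star_eq_adjoint,
    ContinuousLinearMap.adjoint_inner_right]

theorem inner_map_star_left (π : U →⋆ₐ[ℂ] (H →L[ℂ] H)) (a : U) (v w : H) :
    ⟪π (star a) v, w⟫_ℂ = ⟪v, π a w⟫_ℂ := by
  rw [map_star, ContinuousLinearMap.star_eq_adjoint, ContinuousLinearMap.adjoint_inner_left]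

/-- The functional `a ↦ ⟪v, π(a) v⟫`. -/
noncomputable def vectorFunctional (π : U →⋆ₐ[ℂ] (H →L[ℂ] H)) (v : H) : WeakDual ℂ U :=
  StrongDual.toWeakDual
    ((innerSL ℂ v).comp ((ContinuousLinearMap.apply ℂ H v).comp
      (⟨π.toAlgHom.toLinearMap, map_continuous π⟩ : U →L[ℂ] (H →L[ℂ] H))))

@[simp]
theorem vectorFunctional_apply (π : U →⋆ₐ[ℂ] (H →L[ℂ] H)) (v : H) (a : U) :
    vectorFunctional π v a = ⟪v, π a v⟫_ℂ := rfl

variable [PartialOrder U] [StarOrderedRing U]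

theorem inner_map_nonneg (π : U →⋆ₐ[ℂ] (H →L[ℂ] H)) (v : H) {a : U} (ha : 0 ≤ a) :
    0 ≤ ⟪v, π a v⟫_ℂ := by
  obtain ⟨b, rfl⟩ := CStarAlgebra.nonneg_iff_eq_star_mul_self.1 ha
  rw [inner_map_star_mul]
  rw [inner_self_eq_norm_sq_to_K]
  simp

theorem vectorFunctional_mem_stateSpace (π : U →⋆ₐ[ℂ] (H →L[ℂ] H)) {v : H} (hv : ‖v‖ = 1) :
    vectorFunctional π v ∈ stateSpace U := by
  refine ⟨?_, fun a ha => inner_map_nonneg π v ha⟩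
  rw [vectorFunctional_apply, map_one, one_apply_eq_self, inner_self_eq_norm_sq_to_K,
    hv]
  simp

/-- The GNS representation of a pure state is irreducible. -/
theorem eq_bot_or_eq_top_of_mem_extremePoints {ψ : WeakDual ℂ U}
    (hψ : ψ ∈ (stateSpace U).extremePoints ℝ) (π : U →⋆ₐ[ℂ] (H →L[ℂ] H)) {ξ : H}
    (hξ : ∀ a, ⟪ξ, π a ξ⟫_ℂ = ψ a) (hd : DenseRange fun a => π a ξ)
    (K : Submodule ℂ H) (hK : IsClosed (K : Set H)) (hinv : ∀ a, ∀ v ∈ K, π a v ∈ K) :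
    K = ⊥ ∨ K = ⊤ := by
  have : CompleteSpace K := hK.completeSpace_coe
  have htop {L : Submodule ℂ H} (hL : IsClosed (L : Set H)) (hinv : ∀ a, ∀ v ∈ L, π a v ∈ L)
      (hmem : ξ ∈ L) : L = ⊤ := by
    rw [eq_top_iff]
    intro x _
    exact hL.closure_subset_iff.2 (by rintro _ ⟨a, rfl⟩; exact hinv a ξ hmem) (hd x)
  have hinv' : ∀ a, ∀ v ∈ Kᗮ, π a v ∈ Kᗮ := by
    intro a v hv k hk
    rw [← inner_map_star_left]
    exact hv _ (hinv _ k hk)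
  -- Split the cyclic vector along `K` and its invariant complement. If both parts are nonzero, ψ is
  -- a proper convex combination of their normalized vector states.
  obtain ⟨x, hx, y, hy, hxy⟩ := K.exists_add_mem_mem_orthogonal ξ
  by_cases hx0 : x = 0
  · left
    rw [hx0, zero_add] at hxy
    rw [← K.orthogonal_orthogonal, htop K.isClosed_orthogonal hinv' (hxy ▸ hy),
      Submodule.top_orthogonal_eq_bot]
  by_cases hy0 : y = 0
  · right
    rw [hy0, add_zero] at hxy
    exact htop hK hinv (hxy ▸ hx)
  exfalso
  have hsum (a : U) : ψ a = ⟪x, π a x⟫_ℂ + ⟪y, π a y⟫_ℂ := by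
    have h1 : ⟪x, π a y⟫_ℂ = 0 := hinv' a y hy x hx
    have h2 : ⟪y, π a x⟫_ℂ = 0 := Submodule.inner_left_of_mem_orthogonal (hinv a x hx) hy
    rw [← hξ, hxy, map_add, inner_add_left, inner_add_right, inner_add_right, h1, h2]
    ring
  have hxn : 0 < ‖x‖ := norm_pos_iff.2 hx0
  have hyn : 0 < ‖y‖ := norm_pos_iff.2 hy0
  have hnorm : ‖x‖ ^ 2 + ‖y‖ ^ 2 = 1 := by
    have := hsum 1
    rw [hψ.1.1, map_one, one_apply_eq_self, one_apply_eq_self,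
      inner_self_eq_norm_sq_to_K, inner_self_eq_norm_sq_to_K] at this
    have h : ((‖x‖ ^ 2 + ‖y‖ ^ 2 : ℝ) : ℂ) = 1 := by
      push_cast
      exact this.symm
    exact_mod_cast h
  have hscale {v : H} (hv : 0 < ‖v‖) (a : U) :
      ((‖v‖ ^ 2 : ℝ) : ℂ) * vectorFunctional π (((‖v‖⁻¹ : ℝ) : ℂ) • v) a = ⟪v, π a v⟫_ℂ := by
    have : (‖v‖ : ℂ) ≠ 0 := by exact_mod_cast hv.ne'
    simp only [vectorFunctional_apply, map_smul, inner_smul_left, inner_smul_right,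
      Complex.conj_ofReal]
    push_cast
    field_simp
  have hunit {v : H} (hv : 0 < ‖v‖) : ‖((‖v‖⁻¹ : ℝ) : ℂ) • v‖ = 1 := by
    rw [norm_smul, Complex.norm_real, norm_inv, norm_norm, inv_mul_cancel₀ hv.ne']
  have hseg : ψ ∈ openSegment ℝ (vectorFunctional π (((‖x‖⁻¹ : ℝ) : ℂ) • x))
      (vectorFunctional π (((‖y‖⁻¹ : ℝ) : ℂ) • y)) := by
    refine ⟨‖x‖ ^ 2, ‖y‖ ^ 2, by positivity, by positivity, hnorm, ?_⟩
    refine DFunLike.ext _ _ fun a => ?_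
    rw [hsum, ← hscale hxn, ← hscale hyn]
    rfl
  have heq : vectorFunctional π (((‖x‖⁻¹ : ℝ) : ℂ) • x) = ψ :=
    (mem_extremePoints.1 hψ).2 _ (vectorFunctional_mem_stateSpace π (hunit hxn)) _
      (vectorFunctional_mem_stateSpace π (hunit hyn)) hseg |>.1
  -- Extremality makes the vector state of x/‖x‖ equal to ψ; by cyclicity x = ‖x‖² ξ, which is
  -- incompatible with y ≠ 0.
  have hxξ (a : U) : ⟪π a ξ, x - ((‖x‖ ^ 2 : ℝ) : ℂ) • ξ⟫_ℂ = 0 := by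
    have h1 := hscale hxn (star a)
    rw [heq, ← hξ, ← inner_map_star_left, ← inner_map_star_left, star_star] at h1
    have h2 : ⟪π a y, x⟫_ℂ = 0 := Submodule.inner_left_of_mem_orthogonal hx (hinv' a y hy)
    rw [inner_sub_right, inner_smul_right, h1]
    nth_rw 1 [hxy]
    rw [map_add, inner_add_left, h2, add_zero, sub_self]
  have hxξ' : x - ((‖x‖ ^ 2 : ℝ) : ℂ) • ξ = 0 :=
    hd.eq_zero_of_inner_right ℂ hxξ
  have hyy : ⟪y, x - ((‖x‖ ^ 2 : ℝ) : ℂ) • ξ⟫_ℂ = 0 := by rw [hxξ', inner_zero_right]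
  rw [hxy, inner_sub_right, inner_smul_right, inner_add_right,
    Submodule.inner_left_of_mem_orthogonal hx hy, inner_self_eq_norm_sq_to_K] at hyy
  have : ‖x‖ ^ 2 * ‖y‖ ^ 2 = 0 := by
    have : (0 : ℂ) - ((‖x‖ ^ 2 : ℝ) : ℂ) * (0 + (‖y‖ : ℂ) ^ 2) = 0 := hyy
    have h3 : ((‖x‖ ^ 2 * ‖y‖ ^ 2 : ℝ) : ℂ) = 0 := by
      push_cast at this ⊢
      linear_combination -this
    exact_mod_cast h3
  have : 0 < ‖x‖ ^ 2 * ‖y‖ ^ 2 := by positivity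
  linarith

end VectorStates

/-! ### Essential subspaces of a decreasing sequence of ideals -/

section EssentialSubspace

variable {U : Type u} [CStarAlgebra U]
  {H : Type u} [NormedAddCommGroup H] [InnerProductSpace ℂ H] [CompleteSpace H]

open scoped ComplexOrder InnerProductSpace
open Filter Topology

/-- The closed linear span of `π(I) H`. -/
noncomputable def ClosedIdeal.essentialSubspace (I : ClosedIdeal U) (π : U →⋆ₐ[ℂ] (H →L[ℂ] H)) :
    Submodule ℂ H :=
  (Submodule.span ℂ {v | ∃ x ∈ I, ∃ w, π x w = v}).topologicalClosure

theorem ClosedIdeal.map_mem_essentialSubspace {I : ClosedIdeal U} (π : U →⋆ₐ[ℂ] (H →L[ℂ] H))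
    {x : U} (hx : x ∈ I) (v : H) : π x v ∈ I.essentialSubspace π :=
  Submodule.le_topologicalClosure _ (Submodule.subset_span ⟨x, hx, v, rfl⟩)

theorem ClosedIdeal.essentialSubspace_mono {I J : ClosedIdeal U} (h : I ≤ J)
    (π : U →⋆ₐ[ℂ] (H →L[ℂ] H)) : I.essentialSubspace π ≤ J.essentialSubspace π :=
  Submodule.topologicalClosure_mono (Submodule.span_mono fun _ ⟨x, hx, w, hw⟩ => ⟨x, h hx, w, hw⟩)

theorem ClosedIdeal.map_mem_essentialSubspace_of_mem {I : ClosedIdeal U}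
    (π : U →⋆ₐ[ℂ] (H →L[ℂ] H)) (a : U) {v : H} (hv : v ∈ I.essentialSubspace π) :
    π a v ∈ I.essentialSubspace π := by
  have hle : Submodule.span ℂ {v | ∃ x ∈ I, ∃ w, π x w = v} ≤
      (I.essentialSubspace π).comap (π a : H →ₗ[ℂ] H) := by
    rw [Submodule.span_le]
    rintro _ ⟨x, hx, w, rfl⟩
    change π a (π x w) ∈ I.essentialSubspace π
    rw [← mul_apply_eq_comp, ← map_mul]
    exact map_mem_essentialSubspace π (I.mul_mem_left a hx) w
  exact Submodule.topologicalClosure_minimal _ hle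
    ((Submodule.isClosed_topologicalClosure _).preimage (π a).continuous) hv

variable [PartialOrder U] [StarOrderedRing U]

/-- Positive contractions of an ideal approximate the identity on the essential subspace. -/
theorem ClosedIdeal.exists_norm_sub_map_lt (I : ClosedIdeal U) (π : U →⋆ₐ[ℂ] (H →L[ℂ] H)) {v : H}
    (hv : v ∈ I.essentialSubspace π) {ε : ℝ} (hε : 0 < ε) :
    ∃ e ∈ I, 0 ≤ e ∧ e ≤ 1 ∧ ‖v - π e v‖ < ε := by
  let : PartialOrder I.starPart := CStarAlgebra.spectralOrder I.starPart
  let : StarOrderedRing I.starPart := CStarAlgebra.spectralOrderedRing I.starPart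
  have happ := CStarAlgebra.increasingApproximateUnit I.starPart
  have := happ.neBot
  set l := CStarAlgebra.approximateUnit I.starPart
  have hspan : ∀ w ∈ Submodule.span ℂ {v | ∃ x ∈ I, ∃ w, π x w = v},
      Tendsto (fun e : I.starPart => π (e : U) w) l (𝓝 w) := by
    intro w hw
    induction hw using Submodule.span_induction with
    | mem w hw =>
      obtain ⟨x, hx, w, rfl⟩ := hw
      have h1 := happ.tendsto_mul_right (⟨x, hx, I.star_mem hx⟩ : I.starPart)
      have hcont : Continuous fun y : I.starPart => π (y : U) w :=
        ((ContinuousLinearMap.apply ℂ H w).continuous.comp (map_continuous π)).comp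
          continuous_subtype_val
      have h2 := (hcont.tendsto _).comp h1
      refine h2.congr fun e => ?_
      change π ((e : U) * x) w = π (e : U) (π x w)
      rw [map_mul, mul_apply_eq_comp]
    | zero => simp
    | add x y _ _ hx hy => simpa using hx.add hy
    | smul c x _ hx => simpa using hx.const_smul c
  obtain ⟨w, hw, hvw⟩ := Metric.mem_closure_iff.1 hv (ε / 3) (by positivity)
  rw [dist_eq_norm] at hvw
  have hnear := Metric.tendsto_nhds.1 (hspan w hw) (ε / 3) (by positivity)
  obtain ⟨e, hd, he, hn⟩ := (hnear.and (happ.eventually_nonneg.and happ.eventually_norm)).exists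
  have he0 : (0 : U) ≤ (e : U) :=
    ClosedIdeal.map_nonneg_of_starHom (NonUnitalStarSubalgebraClass.subtype I.starPart) he
  have hn' : ‖(e : U)‖ ≤ 1 := hn
  refine ⟨e, e.2.1, he0, (CStarAlgebra.norm_le_one_iff_of_nonneg _ he0).1 hn', ?_⟩
  have hπ : ‖π (e : U)‖ ≤ 1 := (NonUnitalStarAlgHom.norm_apply_le π _).trans hn'
  rw [dist_comm, dist_eq_norm] at hd
  have h1 : ‖π (e : U) (w - v)‖ ≤ ‖v - w‖ := by
    rw [norm_sub_rev v w]
    exact (ContinuousLinearMap.le_opNorm _ _).trans (mul_le_of_le_one_left (norm_nonneg _) hπ)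
  calc ‖v - π (e : U) v‖ = ‖(v - w) + (w - π (e : U) w) + π (e : U) (w - v)‖ := by
        congr 1; rw [map_sub]; abel
    _ ≤ ‖v - w‖ + ‖w - π (e : U) w‖ + ‖π (e : U) (w - v)‖ := norm_add₃_le
    _ < ε := by linarith

/-- Take b = √a e √a, with e a positive contraction of the ideal almost fixing π(√a)v. -/
theorem ClosedIdeal.exists_le_lt_inner (I : ClosedIdeal U) (π : U →⋆ₐ[ℂ] (H →L[ℂ] H)) {v : H}
    (hv : v ∈ I.essentialSubspace π) {c : ℝ} {a : U} (ha : 0 ≤ a) (hc : c < (⟪v, π a v⟫_ℂ).re) :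
    ∃ b ∈ I, 0 ≤ b ∧ b ≤ a ∧ c < (⟪v, π b v⟫_ℂ).re := by
  set r := CFC.sqrt a
  have hr : 0 ≤ r := CFC.sqrt_nonneg a
  have hrr : r * r = a := CFC.sqrt_mul_sqrt_self a ha
  have hrs : star r = r := hr.isSelfAdjoint.star_eq
  have hform (b : U) : ⟪v, π (r * b * r) v⟫_ℂ = ⟪π r v, π b (π r v)⟫_ℂ := by
    have := inner_map_star_mul π r (b * r) v v
    rw [hrs, ← mul_assoc] at this
    rw [this, map_mul, mul_apply_eq_comp]
  have hform1 : ⟪v, π a v⟫_ℂ = ⟪π r v, π r v⟫_ℂ := by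
    have := hform 1
    rwa [mul_one, hrr, map_one, one_apply_eq_self] at this
  obtain ⟨e, he, he0, he1, hlt⟩ := I.exists_norm_sub_map_lt π
    (I.map_mem_essentialSubspace_of_mem π r hv)
    (ε := ((⟪v, π a v⟫_ℂ).re - c) / (‖π r v‖ + 1)) (div_pos (sub_pos.2 hc) (by positivity))
  have hra : IsSelfAdjoint r := hr.isSelfAdjoint
  refine ⟨r * e * r, I.mul_mem_right _ (I.mul_mem_left _ he), hra.conjugate_nonneg he0, ?_, ?_⟩
  · have := hra.conjugate_le_conjugate he1
    rwa [mul_one, hrr] at this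
  · rw [hform]
    have h1 : (⟪v, π a v⟫_ℂ).re - (⟪π r v, π e (π r v)⟫_ℂ).re =
        (⟪π r v, π r v - π e (π r v)⟫_ℂ).re := by
      rw [hform1, inner_sub_right, Complex.sub_re]
    have h2 : (⟪π r v, π r v - π e (π r v)⟫_ℂ).re ≤ ‖π r v‖ * ‖π r v - π e (π r v)‖ :=
      (Complex.re_le_norm _).trans (norm_inner_le_norm _ _)
    rw [lt_div_iff₀ (by positivity)] at hlt
    have h3 : 0 ≤ ‖π r v - π e (π r v)‖ := norm_nonneg _
    nlinarith

/-- If a vector is uniformly moved by positive bounded elements of a decreasing sequence of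
ideals, then the essential subspaces have a nonzero common vector. -/
theorem exists_ne_zero_forall_mem_essentialSubspace {I : ℕ → ClosedIdeal U} (hI : Antitone I)
    (π : U →⋆ₐ[ℂ] (H →L[ℂ] H)) {y : ℕ → U} (hyI : ∀ k, y k ∈ I k) (hy : ∀ k, 0 ≤ y k) {M : ℝ}
    (hM : ∀ k, ‖y k‖ ≤ M) {ξ : H} {c : ℝ} (hc : 0 < c) (hle : ∀ k, c ≤ (⟪ξ, π (y k) ξ⟫_ℂ).re) :
    ∃ ζ : H, ζ ≠ 0 ∧ ∀ k, ζ ∈ (I k).essentialSubspace π := by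
  set E : ℕ → Submodule ℂ H := fun k => (I k).essentialSubspace π with hE
  have hEcl (k) : IsClosed (E k : Set H) := Submodule.isClosed_topologicalClosure _
  have hEc (k) : CompleteSpace (E k) := (hEcl k).completeSpace_coe
  by_contra! hcon
  have hbot : ⨅ k, E k = ⊥ := by
    rw [eq_bot_iff]
    intro ζ hζ
    by_contra h0
    obtain ⟨k, hk⟩ := hcon ζ h0
    exact hk ((Submodule.mem_iInf _).1 hζ k)
  -- Without a common vector the increasing complements of the `E k` have dense union, so ξ is close
  -- to some v in one of them.
  have htop : (⨆ k, (E k)ᗮ).topologicalClosure = ⊤ := by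
    rw [Submodule.topologicalClosure_eq_top_iff, ← Submodule.iInf_orthogonal]
    simpa only [Submodule.orthogonal_orthogonal] using hbot
  have hM0 : 0 ≤ M := (norm_nonneg _).trans (hM 0)
  have hpos : 0 < c / (‖ξ‖ * M + 1) := by positivity
  obtain ⟨v, hv, hlt⟩ := Metric.mem_closure_iff.1
    (show ξ ∈ closure ((⨆ k, (E k)ᗮ : Submodule ℂ H) : Set H) by
      have : ξ ∈ (⨆ k, (E k)ᗮ).topologicalClosure := by rw [htop]; trivial
      exact this) _ hpos
  have hmono : Monotone fun k => (E k)ᗮ := fun k l hkl =>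
    Submodule.orthogonal_le (ClosedIdeal.essentialSubspace_mono (hI hkl) π)
  obtain ⟨k, hk⟩ := (Submodule.mem_iSup_of_directed _ hmono.directed_le).1 hv
  -- π(y_k) is self-adjoint with range in `E k`, so it annihilates the complement.
  have hzero : π (y k) v = 0 := by
    rw [← inner_self_eq_zero (𝕜 := ℂ)]
    nth_rw 1 [← (hy k).isSelfAdjoint.star_eq]
    rw [inner_map_star_left]
    exact Submodule.inner_left_of_mem_orthogonal
      (ClosedIdeal.map_mem_essentialSubspace π (hyI k) _) hk
  rw [dist_eq_norm, lt_div_iff₀ (by positivity)] at hlt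
  have h1 : c ≤ ‖ξ‖ * (M * ‖ξ - v‖) := by
    calc c ≤ (⟪ξ, π (y k) ξ⟫_ℂ).re := hle k
      _ = (⟪ξ, π (y k) (ξ - v)⟫_ℂ).re := by rw [map_sub, hzero, sub_zero]
      _ ≤ ‖ξ‖ * ‖π (y k) (ξ - v)‖ := (Complex.re_le_norm _).trans (norm_inner_le_norm _ _)
      _ ≤ ‖ξ‖ * (M * ‖ξ - v‖) := by
        gcongr
        refine (ContinuousLinearMap.le_opNorm _ _).trans ?_
        gcongr
        exact (NonUnitalStarAlgHom.norm_apply_le π _).trans (hM k)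
  have h2 : 0 ≤ ‖ξ - v‖ := norm_nonneg _
  nlinarith

/-- A decreasing sequence of ideals of a unital C⋆-algebra containing bounded positive elements
whose convex combinations stay away from zero: some irreducible representation does not vanish
on any of the ideals. -/
theorem exists_irreducible_forall_exists_map_ne_zero {I : ℕ → ClosedIdeal U} (hI : Antitone I)
    {y : ℕ → U} (hyI : ∀ k, y k ∈ I k) (hy : ∀ k, 0 ≤ y k) {M : ℝ} (hM : ∀ k, ‖y k‖ ≤ M) {ε : ℝ}
    (hε : 0 < ε) (hle : ∀ w ∈ convexHull ℝ (Set.range y), ε ≤ ‖w‖) :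
    ∃ (H : Type u) (_ : NormedAddCommGroup H) (_ : InnerProductSpace ℂ H) (_ : CompleteSpace H)
      (π : U →⋆ₐ[ℂ] (H →L[ℂ] H)), (∀ K : Submodule ℂ H, IsClosed (K : Set H) →
        (∀ a, ∀ v ∈ K, π a v ∈ K) → K = ⊥ ∨ K = ⊤) ∧ ∀ k, ∃ x ∈ I k, π x ≠ 0 := by
  have hpos : ∀ w ∈ convexHull ℝ (Set.range y), 0 ≤ w := by
    have : convexHull ℝ (Set.range y) ⊆ Set.Ici 0 :=
      convexHull_min (by rintro _ ⟨k, rfl⟩; exact hy k) (convex_Ici 0)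
    exact this
  obtain ⟨f, c, hc, hfc⟩ := exists_positiveLinearMap_forall_le (convex_convexHull ℝ _) hpos hε hle
  obtain ⟨H, _, _, _, π, ξ, hξ, -⟩ := f.exists_cyclic_rep
  obtain ⟨ζ, hζ0, hζ⟩ := exists_ne_zero_forall_mem_essentialSubspace hI π hyI hy hM hc
    (ξ := ξ) fun k => by rw [hξ]; exact hfc _ (subset_convexHull ℝ _ ⟨k, rfl⟩)
  obtain ⟨v, hv1, hv⟩ : ∃ v : H, ‖v‖ = 1 ∧ ∀ k, v ∈ (I k).essentialSubspace π :=
    ⟨((‖ζ‖⁻¹ : ℝ) : ℂ) • ζ, by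
      rw [norm_smul, Complex.norm_real, norm_inv, norm_norm,
        inv_mul_cancel₀ (norm_ne_zero_iff.2 hζ0)],
      fun k => Submodule.smul_mem _ _ (hζ k)⟩
  -- The `y k` need not decrease, but the extreme point argument needs a decreasing sequence. It is
  -- built from a_0 = 1, with a_{k+1} in I_k below a_k; 1/2 is an arbitrary threshold below the
  -- initial value ‖v‖² = 1.
  have hstep (k : ℕ) (a : {a : U // 0 ≤ a ∧ 1 / 2 < (⟪v, π a v⟫_ℂ).re}) :
      ∃ b : {a : U // 0 ≤ a ∧ 1 / 2 < (⟪v, π a v⟫_ℂ).re}, (b : U) ∈ I k ∧ (b : U) ≤ a := by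
    obtain ⟨b, hb, hb0, hba, hlt⟩ := (I k).exists_le_lt_inner π (hv k) a.2.1 a.2.2
    exact ⟨⟨b, hb0, hlt⟩, hb, hba⟩
  choose g hgI hgle using hstep
  let a₀ : {a : U // 0 ≤ a ∧ 1 / 2 < (⟪v, π a v⟫_ℂ).re} := ⟨1, zero_le_one, by
    rw [map_one, one_apply_eq_self, inner_self_eq_norm_sq_to_K, hv1]
    norm_num⟩
  let a : ℕ → {a : U // 0 ≤ a ∧ 1 / 2 < (⟪v, π a v⟫_ℂ).re} :=
    fun n => Nat.rec a₀ (fun k b => g k b) n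
  have haI (k : ℕ) : (a (k + 1)).1 ∈ I k := hgI k (a k)
  have hanti : Antitone fun k : ℕ => (a k).1 :=
    antitone_nat_of_succ_le fun k => hgle k (a k)
  obtain ⟨ψ, hψ, hle⟩ := exists_mem_extremePoints_forall_le
    (WeakDual.instContinuousSMul ℝ)
    (WeakBilin.locallyConvexSpace (B := topDualPairing ℂ U)) (isCompact_stateSpace U) (g := fun k ψ => (ψ (a k).1).re) (c := 1 / 2)
    (fun k => Complex.continuous_re.comp (WeakDual.eval_continuous _))
    (fun k x y => Complex.add_re _ _) (fun k t x => Complex.smul_re _ _)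
    (fun ψ hψ k l hkl => by
      have := hψ.2 _ (sub_nonneg.2 (hanti hkl))
      rw [map_sub] at this
      exact (Complex.le_def.1 (sub_nonneg.1 this)).1)
    (fun k ψ hψ => (Complex.nonneg_iff.1 (hψ.2 _ (a k).2.1)).1)
    (vectorFunctional_mem_stateSpace π hv1) fun k => (a k).2.2.le
  obtain ⟨H', _, _, _, π', ξ', hξ', hd⟩ := (PositiveLinearMap.mk₀
    ((WeakDual.toStrongDual ψ : StrongDual ℂ U) : U →ₗ[ℂ] ℂ) hψ.1.2).exists_cyclic_rep
  refine ⟨H', _, _, _, π', eq_bot_or_eq_top_of_mem_extremePoints hψ π' hξ' hd,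
    fun k => ⟨_, haI k, fun h0 => ?_⟩⟩
  have h1 : ⟪ξ', π' (a (k + 1)).1 ξ'⟫_ℂ = ψ (a (k + 1)).1 := hξ' _
  rw [h0, zero_apply, inner_zero_right] at h1
  have h2 := hle (k + 1)
  simp only [← h1, Complex.zero_re] at h2
  norm_num at h2

end EssentialSubspace

/-! ### Transfer of ideals and hulls to the unitization -/

section UnitizationIdeal

variable {A : Type u} [NonUnitalCStarAlgebra A]

/-- A closed ideal of `A`, viewed as a closed ideal of the unitization. -/
noncomputable def ClosedIdeal.unitization (I : ClosedIdeal A) : ClosedIdeal (Unitization ℂ A) where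
  toSubmodule := I.toSubmodule.map (Unitization.inrHom ℂ ℂ A)
  mul_mem_left' := by
    rintro x _ ⟨a, ha, rfl⟩
    refine ⟨x.fst • a + x.snd * a,
      I.toSubmodule.add_mem (I.toSubmodule.smul_mem _ ha) (I.mul_mem_left _ ha), ?_⟩
    ext <;> simp
  mul_mem_right' := by
    rintro x _ ⟨a, ha, rfl⟩
    refine ⟨x.fst • a + a * x.snd,
      I.toSubmodule.add_mem (I.toSubmodule.smul_mem _ ha) (I.mul_mem_right _ ha), ?_⟩
    ext <;> simp
  isClosed' := (Unitization.isometry_inr (𝕜 := ℂ) (A := A)).isClosedEmbedding.isClosedMap _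
    I.isClosed

theorem ClosedIdeal.unitization_mono {I J : ClosedIdeal A} (h : I ≤ J) :
    I.unitization ≤ J.unitization := fun _ ⟨a, ha, hx⟩ => ⟨a, h ha, hx⟩

variable {H : Type u} [NormedAddCommGroup H] [InnerProductSpace ℂ H] [CompleteSpace H]

/-- The fixed space of π(1) is closed, invariant and contains the range of every π(a), so it is not
0. -/
theorem IsIrreducibleRep.map_one {U : Type u} [CStarAlgebra U] {π : U →⋆ₙₐ[ℂ] (H →L[ℂ] H)}
    (hπ : IsIrreducibleRep π) : π 1 = 1 := by
  let K : Submodule ℂ H := LinearMap.ker ((π 1 - 1 : H →L[ℂ] H) : H →ₗ[ℂ] H)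
  have hmem (v : H) : v ∈ K ↔ π 1 v = v := by
    simp [K, sub_eq_zero]
  have hone (a : U) (v : H) : π 1 (π a v) = π a v := by
    rw [← mul_apply_eq_comp, ← map_mul, one_mul]
  rcases hπ.2 K (ContinuousLinearMap.isClosed_ker (π 1 - 1))
    fun a v _ => (hmem _).2 (hone a v) with h | h
  · obtain ⟨a, ha⟩ := hπ.1
    refine absurd (ContinuousLinearMap.ext fun v => ?_) ha
    have : π a v ∈ K := (hmem _).2 (hone a v)
    rw [h, Submodule.mem_bot] at this
    simpa using this
  · refine ContinuousLinearMap.ext fun v => ?_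
    have : v ∈ K := by rw [h]; trivial
    simpa using (hmem v).1 this

/-- Irreducible representations of the unitization vanish on one of the ideals, if the hulls of
these ideals cover the primitive ideal space. -/
theorem IsIrreducibleRep.exists_forall_map_inr_eq_zero {I : ℕ → ClosedIdeal A}
    (hcover : (⋃ k, (I k).hull) = PrimitiveIdeals A) {π : A⁺¹ →⋆ₙₐ[ℂ] (H →L[ℂ] H)}
    (hπ : IsIrreducibleRep π) : ∃ k, ∀ x ∈ I k, π (x : A⁺¹) = 0 := by
  let σ : A →⋆ₙₐ[ℂ] (H →L[ℂ] H) := π.comp (Unitization.inrNonUnitalStarAlgHom ℂ A)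
  have hσ (a : A) : σ a = π (a : A⁺¹) := rfl
  -- Representations killing `A` kill every ideal. Otherwise the restriction to `A` has the same
  -- invariant subspaces, as π differs from it only by scalars.
  by_cases h0 : ∀ a, σ a = 0
  · exact ⟨0, fun x _ => h0 x⟩
  push Not at h0
  have hdecomp (x : A⁺¹) (v : H) : π x v = x.fst • v + σ x.snd v := by
    have hx : x = x.fst • (1 : A⁺¹) + (x.snd : A⁺¹) := by ext <;> simp
    conv_lhs => rw [hx]
    rw [map_add, map_smul, hπ.map_one, hσ]
    rfl
  have hirr : IsIrreducibleRep σ := ⟨h0, fun K hK hinv => hπ.2 K hK fun x v hv => by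
    rw [hdecomp]
    exact K.add_mem (K.smul_mem _ hv) (hinv _ v hv)⟩
  have hprim : ClosedIdeal.ker σ ∈ PrimitiveIdeals A :=
    ⟨H, _, _, _, σ, hirr, fun a => Iff.rfl⟩
  rw [← hcover] at hprim
  obtain ⟨k, hk⟩ := Set.mem_iUnion.1 hprim
  exact ⟨k, fun x hx => hk.2 hx⟩

theorem iUnion_hull_unitization {I : ℕ → ClosedIdeal A}
    (hcover : (⋃ k, (I k).hull) = PrimitiveIdeals A) :
    (⋃ k, (I k).unitization.hull) = PrimitiveIdeals (Unitization ℂ A) := by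
  refine subset_antisymm (Set.iUnion_subset fun k J hJ => hJ.1) fun J hJ => ?_
  obtain ⟨H, _, _, _, π, hπ, hker⟩ := id hJ
  obtain ⟨k, hk⟩ := hπ.exists_forall_map_inr_eq_zero hcover
  refine Set.mem_iUnion.2 ⟨k, hJ, ?_⟩
  rintro _ ⟨a, ha, rfl⟩
  exact (hker _).2 (hk a ha)

end UnitizationIdeal

/-! ### The Stone-Weierstrass theorem -/

section StoneWeierstrass

variable {A : Type u} [NonUnitalCStarAlgebra A]

/-- Classes coming from `B` lift to `B` almost isometrically. The bound does not depend on the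
ideal, which keeps the y_k bounded. -/
theorem ClosedIdeal.exists_mem_sub_mem_norm_le (I : ClosedIdeal A)
    {B : NonUnitalStarSubalgebra ℂ A} (hB : IsClosed (B : Set A)) {x : A}
    (h : ∃ b ∈ B, x - b ∈ I) : ∃ b ∈ B, x - b ∈ I ∧ ‖b‖ ≤ ‖x‖ + 1 := by
  obtain ⟨b, hb, hxb⟩ := h
  obtain ⟨c, hc, hlt⟩ := exists_lift_norm_lt_starHom
    ((Quotient.mkHom I).comp (NonUnitalStarSubalgebraClass.subtype B)) ⟨b, hb⟩ one_pos
  have h1 : Quotient.mk I c = Quotient.mk I b := hc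
  have h2 : Quotient.mk I x = Quotient.mk I b := (Quotient.mk_eq_mk I).2 hxb
  refine ⟨c, c.2, (Quotient.mk_eq_mk I).1 (h2.trans h1.symm), ?_⟩
  have h3 : ‖c‖ < ‖Quotient.mk I b‖ + 1 := hlt
  have h4 := Quotient.norm_mk_le I x
  rw [h2] at h4
  change ‖c‖ ≤ _
  linarith

/-- A Stone-Weierstrass theorem: a closed ⋆-subalgebra that maps onto every quotient `A / I k`
is everything, if the `I k` decrease and their hulls cover the primitive ideal space. -/
theorem eq_top_of_forall_exists_sub_mem {I : ℕ → ClosedIdeal A} (hI : Antitone I)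
    (hcover : (⋃ k, (I k).hull) = PrimitiveIdeals A) {B : NonUnitalStarSubalgebra ℂ A}
    (hB : IsClosed (B : Set A)) (hsurj : ∀ k x, ∃ b ∈ B, x - b ∈ I k) : B = ⊤ := by
  let : PartialOrder A⁺¹ := CStarAlgebra.spectralOrder A⁺¹
  let : StarOrderedRing A⁺¹ := CStarAlgebra.spectralOrderedRing A⁺¹
  rw [eq_top_iff]
  intro x _
  by_contra hx
  obtain ⟨δ, hδ, hdist⟩ : ∃ δ : ℝ, 0 < δ ∧ ∀ b ∈ B, δ ≤ ‖x - b‖ := by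
    have hx' : x ∉ closure (B : Set A) := by rwa [hB.closure_eq]
    rw [Metric.mem_closure_iff] at hx'
    push Not at hx'
    obtain ⟨δ, hδ, h⟩ := hx'
    exact ⟨δ, hδ, fun b hb => by rw [← dist_eq_norm]; exact h b hb⟩
  choose b hbB hbI hbn using fun k => (I k).exists_mem_sub_mem_norm_le hB (hsurj k x)
  -- The upper bounds of the squares |m|², m in x + B: a convex set containing all y_k, with norms
  -- at least δ².
  set S : Set A⁺¹ := {w | ∃ m : A, x - m ∈ B ∧ ((star m * m : A) : A⁺¹) ≤ w} with hS
  have hSconv : Convex ℝ S := by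
    rintro w₁ ⟨m₁, hm₁, hle₁⟩ w₂ ⟨m₂, hm₂, hle₂⟩ s t hs ht hst
    refine ⟨s • m₁ + t • m₂, ?_, ?_⟩
    · have h1 : x - (s • m₁ + t • m₂) = s • (x - m₁) + t • (x - m₂) := by
        rw [smul_sub, smul_sub]
        nth_rw 1 [← one_smul ℝ x]
        rw [← hst, add_smul]
        abel
      rw [h1, ← Complex.coe_smul, ← Complex.coe_smul]
      exact add_mem (SMulMemClass.smul_mem _ hm₁) (SMulMemClass.smul_mem _ hm₂)
    · obtain rfl : t = 1 - s := by linarith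
      -- The convexity defect of m ↦ m*m is s(1 - s)|m₁ - m₂|².
      have hid : s • ((star m₁ * m₁ : A) : A⁺¹) + (1 - s) • ((star m₂ * m₂ : A) : A⁺¹) -
          ((star (s • m₁ + (1 - s) • m₂) * (s • m₁ + (1 - s) • m₂) : A) : A⁺¹) =
          (s * (1 - s)) • (star ((m₁ - m₂ : A) : A⁺¹) * ((m₁ - m₂ : A) : A⁺¹)) := by
        simp only [Unitization.inr_sub, Unitization.inr_mul, Unitization.inr_add,
          Unitization.inr_smul, Unitization.inr_star, star_add, star_sub, star_smul, star_trivial,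
          mul_add, add_mul, mul_sub, sub_mul, smul_mul_assoc, mul_smul_comm, smul_add, smul_sub,
          smul_smul]
        module
      have hnn : (0 : A⁺¹) ≤
          (s * (1 - s)) • (star ((m₁ - m₂ : A) : A⁺¹) * ((m₁ - m₂ : A) : A⁺¹)) :=
        smul_nonneg (mul_nonneg hs ht) (star_mul_self_nonneg _)
      rw [← hid, sub_nonneg] at hnn
      exact hnn.trans (add_le_add (smul_le_smul_of_nonneg_left hle₁ hs)
        (smul_le_smul_of_nonneg_left hle₂ ht))
  have hSnorm : ∀ w ∈ S, δ ^ 2 ≤ ‖w‖ := by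
    rintro w ⟨m, hm, hle⟩
    have h1 := hdist _ hm
    rw [sub_sub_cancel] at h1
    calc δ ^ 2 ≤ ‖m‖ ^ 2 := by gcongr
      _ = ‖((star m * m : A) : A⁺¹)‖ := by
        rw [Unitization.norm_inr, CStarRing.norm_star_mul_self, sq]
      _ ≤ ‖w‖ := by
        refine CStarAlgebra.norm_le_norm_of_nonneg_of_le ?_ hle
        rw [Unitization.inr_mul, Unitization.inr_star]
        exact star_mul_self_nonneg _
  let y : ℕ → A⁺¹ := fun k => ((star (x - b k) * (x - b k) : A) : A⁺¹)
  have hyS : convexHull ℝ (Set.range y) ⊆ S := by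
    refine convexHull_min ?_ hSconv
    rintro _ ⟨k, rfl⟩
    exact ⟨x - b k, by rw [sub_sub_cancel]; exact hbB k, le_rfl⟩
  obtain ⟨H, _, _, _, π, hirr, hne⟩ := exists_irreducible_forall_exists_map_ne_zero
    (I := fun k => (I k).unitization) (fun k l hkl => ClosedIdeal.unitization_mono (hI hkl))
    (y := y) (fun k => ⟨_, (I k).mul_mem_left _ (hbI k), rfl⟩)
    (fun k => by
      change (0 : A⁺¹) ≤ ((star (x - b k) * (x - b k) : A) : A⁺¹)
      rw [Unitization.inr_mul, Unitization.inr_star]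
      exact star_mul_self_nonneg _)
    (M := (‖x‖ + (‖x‖ + 1)) ^ 2)
    (fun k => by
      change ‖((star (x - b k) * (x - b k) : A) : A⁺¹)‖ ≤ _
      rw [Unitization.norm_inr, CStarRing.norm_star_mul_self, ← sq]
      gcongr
      exact (norm_sub_le _ _).trans (by gcongr; exact hbn k))
    (pow_pos hδ 2) fun w hw => hSnorm w (hyS hw)
  have hrep : IsIrreducibleRep (π : A⁺¹ →⋆ₙₐ[ℂ] (H →L[ℂ] H)) :=
    ⟨let ⟨x, _, hx⟩ := hne 0; ⟨x, hx⟩, hirr⟩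
  obtain ⟨k, hk⟩ := hrep.exists_forall_map_inr_eq_zero hcover
  obtain ⟨_, ⟨a, ha, rfl⟩, hne⟩ := hne k
  exact hne (hk a ha)

end StoneWeierstrass

/-! ### Both rank formulas -/

section GeneratorRank

variable {A : Type u} [NonUnitalCStarAlgebra A]

/-- Arbitrary surjections with kernel inside `I k` cover both A/I_k and its forced unitization, a
quotient of the unitization of `A`. -/
theorem gr₀_eq_iSup_of_surjective [TopologicalSpace.SeparableSpace A] {I : ℕ → ClosedIdeal A}
    (hI : Antitone I) (hcover : (⋃ k, (I k).hull) = PrimitiveIdeals A) {B : ℕ → Type u}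
    [∀ k, NonUnitalCStarAlgebra (B k)] (f : ∀ k, A →⋆ₙₐ[ℂ] B k)
    (hf : ∀ k, Function.Surjective (f k)) (hker : ∀ k a, f k a = 0 → a ∈ I k) :
    gr₀ A = ⨆ k, gr₀ (B k) := by
  refine gr₀_eq_iSup_of_forall_genRankLE_iff fun n =>
    ⟨fun h k => h.of_surjective (f k) (hf k), genRankLE_of_forall_surjective f hf ?_⟩
  intro S hS hsurj
  refine eq_top_of_forall_exists_sub_mem hI hcover hS fun k x => ?_
  obtain ⟨y, hy, hxy⟩ := hsurj k (f k x)
  exact ⟨y, hy, hker k _ (by rw [map_sub, hxy, sub_self])⟩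

instance separableSpace_unitization [TopologicalSpace.SeparableSpace A] :
    TopologicalSpace.SeparableSpace (Unitization ℂ A) := by
  have hsurj : Function.Surjective
      fun p : ℂ × A => p.1 • (1 : A⁺¹) + (p.2 : A⁺¹) := fun x =>
    ⟨(x.fst, x.snd), by ext <;> simp⟩
  refine hsurj.denseRange.separableSpace ?_
  exact (continuous_fst.smul continuous_const).add
    (Unitization.isometry_inr.continuous.comp continuous_snd)

theorem starMap_surjective {B : Type u} [NonUnitalCStarAlgebra B] (f : A →⋆ₙₐ[ℂ] B)
    (hf : Function.Surjective f) :
    Function.Surjective ((Unitization.starMap f : A⁺¹ →⋆ₐ[ℂ] B⁺¹) : A⁺¹ →⋆ₙₐ[ℂ] B⁺¹) := by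
  intro x
  obtain ⟨a, ha⟩ := hf x.snd
  refine ⟨x.fst • (1 : A⁺¹) + (a : A⁺¹), ?_⟩
  change Unitization.starMap f _ = x
  ext <;> simp [ha, Unitization.algebraMap_eq_inl]

theorem gr₀_unitization_eq_iSup [TopologicalSpace.SeparableSpace A] {I : ℕ → ClosedIdeal A}
    (hI : Antitone I) (hcover : (⋃ k, (I k).hull) = PrimitiveIdeals A) :
    gr₀ (Unitization ℂ A) = ⨆ k, gr₀ (Unitization ℂ (I k).Quotient) := by
  refine gr₀_eq_iSup_of_surjective (I := fun k => (I k).unitization)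
    (fun k l hkl => ClosedIdeal.unitization_mono (hI hkl)) (iUnion_hull_unitization hcover)
    (fun k => ((Unitization.starMap (ClosedIdeal.Quotient.mkHom (I k)) :
      A⁺¹ →⋆ₐ[ℂ] (I k).Quotient⁺¹) : A⁺¹ →⋆ₙₐ[ℂ] (I k).Quotient⁺¹))
    (fun k => starMap_surjective _ (ClosedIdeal.Quotient.mk_surjective (I k))) fun k a ha => ?_
  change Unitization.starMap (ClosedIdeal.Quotient.mkHom (I k)) a = 0 at ha
  have h1 := congrArg (fun x => x.fst) ha
  have h2 := congrArg (fun x => x.snd) ha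
  simp only [Unitization.starMap_apply, Unitization.algebraMap_eq_inl, Unitization.fst_add,
    Unitization.snd_add, Unitization.fst_inl, Unitization.snd_inl, Unitization.fst_inr,
    Unitization.snd_inr, add_zero, zero_add, Unitization.fst_zero, Unitization.snd_zero] at h1 h2
  refine ⟨a.snd, (ClosedIdeal.Quotient.mk_eq_zero _).1 h2, ?_⟩
  ext <;> simp [h1]

/-- For separable C⋆-algebras, the generator rank may be computed in the forced unitization. -/
theorem gr_eq_gr₀_unitization [TopologicalSpace.SeparableSpace A] :
    gr A = gr₀ (Unitization ℂ A) := by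
  by_cases h : HasUnit A
  · rw [gr₀_unitization_of_hasUnit h]
    exact if_pos h
  · exact if_neg h

end GeneratorRank

theorem proposition4 (A : Type u) [NonUnitalCStarAlgebra A] [TopologicalSpace.SeparableSpace A]
    (I : ℕ → ClosedIdeal A) (hI : Antitone I)
    (hcover : (⋃ k, (I k).hull) = PrimitiveIdeals A) :
    gr₀ A = (⨆ k, gr₀ (I k).Quotient) ∧ gr A = (⨆ k, gr (I k).Quotient) := by
  have hsep (k : ℕ) : TopologicalSpace.SeparableSpace (I k).Quotient :=
    (ClosedIdeal.Quotient.mk_surjective (I k)).denseRange.separableSpace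
      (map_continuous (ClosedIdeal.Quotient.mkHom (I k)))
  refine ⟨gr₀_eq_iSup_of_surjective hI hcover (fun k => ClosedIdeal.Quotient.mkHom (I k))
    (fun k => ClosedIdeal.Quotient.mk_surjective (I k))
    fun k a => (ClosedIdeal.Quotient.mk_eq_zero (I k)).1, ?_⟩
  -- Forced unitizations avoid a case split: A/I_k can be unital when `A` is not.
  simp only [gr_eq_gr₀_unitization]
  exact gr₀_unitization_eq_iSup hI hcover
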